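/- Conventions. A language (problem) is a set $Q\subseteq\{0,1\}^*$. For $q:\mathbb{N}\to\mathbb{R}$, $Q$ is $q$-sparse if $|Q\cap\{0,1\}^n|\le q(n)$ for all $n\in\mathbb{N}$. A circuit has inner gates labeled $\neg,\wedge,\vee$ of fan-in at most $2$ and unbounded fan-out; its size is the number of these gates (input variables are not counted). For $s:\mathbb{N}\to\mathbb{R}$, $\mathsf{SIZE}[s]$ is the class of languages $Q$ such that for all sufficiently large $n$ there is a circuit of size at most $s(n)$ that accepts exactly the strings of $Q$ among those of length $n$. $\mathsf{NTIME}[T]$ is the class of languages $Q$ accepted by a nondeterministic multitape Turing machine that has, on every $x\in Q$, an accepting computation of $O(T(|x|))$ steps (and, on $x\notin Q$, no accepting computation), and $\mathsf{NE}=\mathsf{NTIME}[2^{O(n)}]=\bigcup_{k\in\mathbb{N}}\mathsf{NTIME}[2^{kn}]$. Theorem. For all $c\in\mathbb{N}$, all reals $\delta>0$ and $\gamma<\delta/(c+1)$, and all $2^{n^\gamma}$-sparse problems $Q\in\mathsf{NTIME}[2^{n^\gamma}]$: if $Q\notin\mathsf{SIZE}[n^{1+\delta}]$, then $\mathsf{NE}\not\subseteq\mathsf{SIZE}[n^c]$.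 -/

import Mathlib

namespace Magnification

/-! ### Boolean circuits -/

/-- A gate whose inputs are taken from a type `W` of wires: `¬` of fan-in one, `∧` and `∨` of
fan-in two, and `∧`, `∨` of fan-in zero, which are the constants `1`, `0`. (A gate `∧` or `∨` of
fan-in one is `and a a`, `or a a`.) -/
inductive Gate (W : Type) : Type
  | tru : Gate W
  | fls : Gate W
  | not (a : W) : Gate W
  | and (a b : W) : Gate W
  | or (a b : W) : Gate W

/-- The value of a gate, given the values of the wires. -/
def Gate.eval {W : Type} (v : W → Bool) : Gate W → Bool
  | .tru => true
  | .fls => false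
  | .not a => !(v a)
  | .and a b => v a && v b
  | .or a b => v a || v b

/-- `Gates n s`: a list of `s` gates over `n` input variables, in topological order: the inputs of
a gate are input variables or earlier gates. The fan-out is unbounded. -/
inductive Gates (n : ℕ) : ℕ → Type
  | nil : Gates n 0
  | snoc {s : ℕ} (G : Gates n s) (g : Gate (Fin n ⊕ Fin s)) : Gates n (s + 1)

/-- The values of all gates on the input `x`. -/
def Gates.val {n : ℕ} (x : Fin n → Bool) : {s : ℕ} → Gates n s → (Fin s → Bool)
  | _, .nil => Fin.elim0
  | _, .snoc G g => Fin.snoc (α := fun _ => Bool) (G.val x) (g.eval (Sum.elim x (G.val x)))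

/-- A Boolean circuit with `n` input variables; `size` is its number of gates, `out` the input
variable or gate that carries the output. -/
structure Circuit (n : ℕ) : Type where
  size : ℕ
  gates : Gates n size
  out : Fin n ⊕ Fin size

/-- The output of a circuit on the input `x`. -/
def Circuit.eval {n : ℕ} (C : Circuit n) (x : Fin n → Bool) : Bool :=
  Sum.elim x (C.gates.val x) C.out

/-- `SIZE[s]`: for all sufficiently large `n`, the strings of length `n` are decided by a circuit
of size at most `s n`. -/
def SIZE (s : ℕ → ℝ) : Set (Language Bool) :=
  {L | ∀ᶠ n : ℕ in Filter.atTop, ∃ C : Circuit n, (C.size : ℝ) ≤ s n ∧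
    ∀ x : Fin n → Bool, C.eval x = true ↔ List.ofFn x ∈ L}

/-! ### Nondeterministic time -/

/-- A nondeterministic Turing machine with `k + 1` two-way infinite read-write tapes, a finite set
of states and a finite tape alphabet whose blank symbol is `default`. The input is written on
tape `0`, via `symb`. A move depends on the state and on the scanned symbols; it gives the new
state and, for each tape, the symbol to write and where to move the head (`none`: it stays). -/
structure NTM : Type 1 where
  k : ℕ
  State : Type
  finiteState : Finite State
  Sym : Type
  finiteSym : Finite Sym
  blank : Inhabited Sym
  symb : Bool → Sym
  symb_injective : Function.Injective symb
  symb_ne_blank : ∀ b, symb b ≠ default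
  start : State
  accept : State
  moves : State → (Fin (k + 1) → Sym) → Set (State × (Fin (k + 1) → Sym × Option Turing.Dir))

attribute [instance] NTM.blank

namespace NTM

variable (M : NTM)

/-- A configuration: the state and the tapes with their heads. -/
structure Cfg : Type where
  state : M.State
  tape : Fin (M.k + 1) → Turing.Tape M.Sym

/-- The initial configuration on `x`: the head of tape `0` scans the first symbol of `x`, and the
other tapes are blank. -/
def init (x : List Bool) : M.Cfg where
  state := M.start
  tape := fun i => if i = 0 then Turing.Tape.mk₁ (x.map M.symb) else Turing.Tape.mk₁ []

/-- Write the symbol and then move the head. -/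
def act (T : Turing.Tape M.Sym) (a : M.Sym × Option Turing.Dir) : Turing.Tape M.Sym :=
  match a.2 with
  | none => T.write a.1
  | some d => (T.write a.1).move d

/-- `M.Step c c'`: the configuration `c'` is a possible successor of `c`. -/
def Step (c c' : M.Cfg) : Prop :=
  ∃ m ∈ M.moves c.state (fun i => (c.tape i).head),
    c'.state = m.1 ∧ ∀ i, c'.tape i = M.act (c.tape i) (m.2 i)

/-- `M.StepsIn t c c'`: some computation leads from `c` to `c'` in exactly `t` steps. -/
def StepsIn : ℕ → M.Cfg → M.Cfg → Prop
  | 0, c, c' => c = c'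
  | t + 1, c, c' => ∃ d, M.Step c d ∧ StepsIn t d c'

/-- Some computation of `M` on `x` reaches the accepting state after exactly `t` steps. -/
def AcceptsIn (x : List Bool) (t : ℕ) : Prop :=
  ∃ c, M.StepsIn t (M.init x) c ∧ c.state = M.accept

end NTM

/-- `NTIME[T]`: the languages `L` accepted by a nondeterministic multitape Turing machine such
that each `x ∈ L` has an accepting computation of `O(T(|x|))` steps, and no `x ∉ L` has an
accepting computation (of any length). -/
def NTIME (T : ℕ → ℝ) : Set (Language Bool) :=
  {L | ∃ (M : NTM) (C : ℝ), ∀ x : List Bool,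
    (x ∈ L → ∃ t : ℕ, (t : ℝ) ≤ C * T x.length ∧ M.AcceptsIn x t) ∧
    (x ∉ L → ∀ t : ℕ, ¬ M.AcceptsIn x t)}

/-- `NE`: nondeterministic time `2^{O(n)}`. -/
def NE : Set (Language Bool) :=
  ⋃ k : ℕ, NTIME (fun n => (2 : ℝ) ^ (k * n))

/-- `Q` is `q`-sparse: it has at most `q n` strings of each length `n`. -/
def IsSparse (q : ℕ → ℝ) (Q : Language Bool) : Prop :=
  ∀ n : ℕ, (({x : List Bool | x ∈ Q ∧ x.length = n}.ncard : ℕ) : ℝ) ≤ q n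

end Magnification

/-! The contrapositive is proved: from circuits of size `n ^ c` for `NE`, circuits of size `n ^ (1 +
δ)` for `Q` are built. Let `M` accept `Q`, choose `β` strictly between `max γ 0` and `δ / (c + 1)`,
and put `m = ⌈n ^ β⌉`.

Hashing. Read strings of length `n` as numbers. The difference of two distinct ones has at most `n`
prime factors, so a sparse slice of `Q` spoils only few primes, whereas Chebyshev's bound gives
about `2 ^ m / m` primes below `2 ^ m`. Hence some prime `p < 2 ^ m` exceeds the time bound of `M`
and has pairwise distinct residues on the slice (`exists_modulus_injOn`). It depends on `n` only and
is hardwired.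

Queries. `hashLang M` asks, given `p, v, i, n` in binary, whether some string of length `n` and
residue `v` modulo `p`, with bit `1` at index `i`, is accepted by `M` within `p` steps. A query has
length only `4 * m`, and a nondeterministic machine answers it in time exponential in that length,
even with unary arithmetic, so `hashLang M ∈ NE` (`hashLang_mem_NE`). By assumption, queries have
circuits of size `(4 * m) ^ c`.

Decision. At most one string `u` of the slice has the residue of `x`, so the queries with varying
`i` spell out `u`. Thus `x ∈ Q` iff query `0` (no condition on bits) succeeds and query `k + 1`
returns the corresponding bit of `x` for all `k` (`exists_circuit_of_injOn`). The residue costs `O(n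
* m)` gates by Horner's rule, the queries `n + 1` copies of the small circuit; since `β * (c + 1) <
δ`, the total is at most `n ^ (1 + δ)` for large `n`.

The machine is programmed as a counter machine whose registers are compiled to head positions on
extra tapes. -/

open Turing

namespace Magnification

/-! ### Counter machines with auxiliary tapes -/

/-- A move of a counter machine with registers `R` and auxiliary tapes over `Γ` indexed by `Fin m`:
the new state, whether the head of the input moves right, for each register whether it is
decremented (`left`) or incremented (`right`), and the actions on the auxiliary tapes. -/
structure CMove (R Γ St : Type) (m : ℕ) : Type where
  next : St
  adv : Bool
  ops : R → Option Dir
  acts : Fin m → Γ × Option Dir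

/-- The data of a configuration: the input already read (reversed) and still to be read, the
registers and the auxiliary tapes. -/
@[ext] structure CData (R Γ : Type) [Inhabited Γ] (m : ℕ) : Type where
  done : List Bool
  rest : List Bool
  cnt : R → ℕ
  tape : Fin m → Tape Γ

/-- Write a symbol and then move the head. -/
def actTape {Γ : Type} [Inhabited Γ] (T : Tape Γ) (a : Γ × Option Dir) : Tape Γ :=
  match a.2 with
  | none => T.write a.1
  | some d => (T.write a.1).move d

/-- Apply an operation to the value of a register. -/
def opVal : Option Dir → ℕ → ℕ
  | none, v => v
  | some .left, v => v - 1
  | some .right, v => v + 1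

/-- A nondeterministic counter machine with auxiliary tapes: the available moves depend on the
state, the scanned input bit, the set of registers that are zero, and the symbols scanned on the
auxiliary tapes. -/
structure CMachine (R Γ : Type) (m : ℕ) : Type 1 where
  St : Type
  start : St
  accept : St
  prog : St → Option Bool → (R → Prop) → (Fin m → Γ) → Set (CMove R Γ St m)

section

variable {R Γ St : Type} [Inhabited Γ] {m : ℕ}

/-- The effect of a move on the data. -/
def CMove.apply (v : CMove R Γ St m) (d : CData R Γ m) : CData R Γ m where
  done := if v.adv then d.rest.head?.toList ++ d.done else d.done
  rest := if v.adv then d.rest.tail else d.rest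
  cnt := fun r => opVal (v.ops r) (d.cnt r)
  tape := fun i => actTape (d.tape i) (v.acts i)

/-- A move is valid if it neither reads beyond the input nor decrements a register that is zero. -/
def CMove.Valid (v : CMove R Γ St m) (d : CData R Γ m) : Prop :=
  (v.adv = true → d.rest.head? ≠ none) ∧ ∀ r, v.ops r = some .left → d.cnt r ≠ 0

/-- The moves of a counter machine in state `q` on data `d`. -/
def CMachine.movesAt (P : CMachine R Γ m) (q : P.St) (d : CData R Γ m) :
    Set (CMove R Γ P.St m) :=
  {v ∈ P.prog q d.rest.head? (fun r => d.cnt r = 0) (fun i => (d.tape i).head) | v.Valid d}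

/-- `P.Acc t q d`: from state `q` and data `d`, some computation of `t` steps accepts. -/
def CMachine.Acc (P : CMachine R Γ m) : ℕ → P.St → CData R Γ m → Prop
  | 0, q, _ => q = P.accept
  | t + 1, q, d => ∃ v ∈ P.movesAt q d, Acc P t v.next (v.apply d)

end

/-! ### Compilation of counter machines -/

section

variable {Γ : Type} [Inhabited Γ]

/-- The tape of a register with value `v`: a mark, `v` cells to the left of the head. -/
def counterTape (mark : Γ) : ℕ → Tape Γ
  | 0 => (Tape.mk₁ []).write mark
  | v + 1 => (counterTape mark v).move .right

/-- The mark lies `v` cells to the left of the head, so a cell at or right of the head carries it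
only if both numbers vanish. The offset `i` is needed for the induction; only `i = 0` is used later.
-/
theorem counterTape_nth (mark : Γ) (v i : ℕ) :
    (counterTape mark v).nth i = if i + v = 0 then mark else default := by
  induction v generalizing i with
  | zero =>
    rw [counterTape, Tape.write_nth]
    cases i with
    | zero => simp
    | succ i =>
      have : ((i + 1 : ℕ) : ℤ) ≠ 0 := by omega
      rw [if_neg this, Tape.mk₁, Tape.mk₂, Tape.mk'_nth_nat]
      simp [ListBlank.nth_mk]
  | succ v ih =>
    rw [counterTape, Tape.move_right_nth]
    have := ih (i + 1)
    push_cast at this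
    rw [this]
    congr 1
    simp

theorem counterTape_head {mark : Γ} (hm : mark ≠ default) (v : ℕ) :
    (counterTape mark v).head = mark ↔ v = 0 := by
  have := counterTape_nth mark v 0
  rw [Nat.cast_zero, Tape.nth_zero] at this
  rw [this]
  rcases v with _ | v <;> simp [hm.symm]

theorem actTape_counterTape (mark : Γ) (o : Option Dir) (v : ℕ) (h : o = some .left → v ≠ 0) :
    actTape (counterTape mark v) ((counterTape mark v).head, o) =
      counterTape mark (opVal o v) := by
  rcases o with _ | _ | _
  · simp [actTape, opVal]
  · obtain ⟨w, rfl⟩ := Nat.exists_eq_succ_of_ne_zero (h rfl)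
    simp [actTape, opVal, counterTape]
  · simp [actTape, opVal, counterTape]

/-- The input tape, when `done` (reversed) has been read and `rest` is still to be read. -/
def inputTape (symb : Bool → Γ) (done rest : List Bool) : Tape Γ :=
  Tape.mk' (ListBlank.mk (done.map symb)) (ListBlank.mk (rest.map symb))

open Classical in
/-- The bit that a tape symbol stands for. -/
noncomputable def symbolBit (symb : Bool → Γ) (a : Γ) : Option Bool :=
  if a = symb true then some true else if a = symb false then some false else none

theorem symbolBit_inputTape {symb : Bool → Γ} (hi : Function.Injective symb)
    (hb : ∀ b, symb b ≠ default) (done rest : List Bool) :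
    symbolBit symb (inputTape symb done rest).head = rest.head? := by
  have hft : symb false ≠ symb true := fun h => by simpa using hi h
  rcases rest with _ | ⟨_ | _, l⟩
  · simp [inputTape, symbolBit, (hb _).symm]
  · simp [inputTape, symbolBit, hft]
  · simp [inputTape, symbolBit]

theorem actTape_inputTape (symb : Bool → Γ) (done rest : List Bool) (adv : Bool)
    (h : adv = true → rest.head? ≠ none) :
    actTape (inputTape symb done rest)
        ((inputTape symb done rest).head, if adv then some .right else none) =
      inputTape symb (if adv then rest.head?.toList ++ done else done)
        (if adv then rest.tail else rest) := by
  cases adv with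
  | false => simp [actTape]
  | true =>
    rcases rest with _ | ⟨b, l⟩
    · simp at h
    · simp [actTape, inputTape]

end

theorem NTM.Cfg.ext_tapes {M : NTM} {c c' : M.Cfg} (h : c.state = c'.state)
    (ht : ∀ i, c.tape i = c'.tape i) : c = c' := by
  cases c
  cases c'
  cases h
  cases funext ht
  rfl

namespace CMachine

variable {R : Type} [Fintype R] (M : NTM) (P : CMachine R M.Sym (M.k + 1))

/-- The tapes of the compiled machine: input tape, registers, auxiliary tapes. -/
noncomputable def tapeEquiv (R : Type) [Fintype R] (m : ℕ) :
    Fin (Fintype.card R + m + 1) ≃ Option (R ⊕ Fin m) :=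
  (finSuccEquiv _).trans (Equiv.optionCongr
    (finSumFinEquiv.symm.trans (Equiv.sumCongr (Fintype.equivFin R).symm (Equiv.refl _))))

theorem tapeEquiv_zero (R : Type) [Fintype R] (m : ℕ) : tapeEquiv R m 0 = none := by
  simp [tapeEquiv]

/-- The multitape Turing machine that simulates a counter machine; register values are head
positions. The state `none` marks the origins of the register tapes. -/
noncomputable def compile [Finite P.St] : NTM where
  k := Fintype.card R + (M.k + 1)
  State := Option P.St
  finiteState := inferInstance
  Sym := M.Sym
  finiteSym := M.finiteSym
  blank := M.blank
  symb := M.symb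
  symb_injective := M.symb_injective
  symb_ne_blank := M.symb_ne_blank
  start := none
  accept := some P.accept
  moves := fun q f =>
    let g : Option (R ⊕ Fin (M.k + 1)) → M.Sym := f ∘ (tapeEquiv R (M.k + 1)).symm
    match q with
    -- `M` lends only its alphabet and its number of tapes. The symbol `M.symb true` serves as the
    -- mark of the origins because it is known not to be blank.
    | none => {(some P.start, fun i => match tapeEquiv R (M.k + 1) i with
        | some (.inl _) => (M.symb true, none)
        | _ => (f i, none))}
    | some q => {a | ∃ v ∈ P.prog q (symbolBit M.symb (g none))
          (fun r => g (some (.inl r)) = M.symb true) (fun i => g (some (.inr i))),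
        -- Validity of a move can be read off the scanned symbols, so the transition relation itself
        -- enforces it.
        (v.adv = true → symbolBit M.symb (g none) ≠ none) ∧
        (∀ r, v.ops r = some .left → g (some (.inl r)) ≠ M.symb true) ∧
        a = (some v.next, fun i => match tapeEquiv R (M.k + 1) i with
          | none => (f i, if v.adv then some .right else none)
          | some (.inl r) => (f i, v.ops r)
          | some (.inr j) => v.acts j)}

variable {P}

/-- The tapes that represent the data of a counter machine. -/
def repTape (d : CData R M.Sym (M.k + 1)) : Option (R ⊕ Fin (M.k + 1)) → Tape M.Sym
  | none => inputTape M.symb d.done d.rest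
  | some (.inl r) => counterTape (M.symb true) (d.cnt r)
  | some (.inr j) => d.tape j

/-- The configuration of the compiled machine that represents a configuration of a counter
machine. -/
noncomputable def rep [Finite P.St] (q : P.St) (d : CData R M.Sym (M.k + 1)) : (compile M P).Cfg where
  state := some q
  tape := fun i => repTape M d (tapeEquiv R (M.k + 1) i)

/-- The simulation is step for step: one move of the counter machine is one move of the compiled
machine, so acceptance times agree exactly apart from the initial marking step. -/
theorem step_rep_iff [Finite P.St] (q : P.St) (d : CData R M.Sym (M.k + 1))
    (c : (compile M P).Cfg) :
    (compile M P).Step (rep M q d) c ↔ ∃ v ∈ P.movesAt q d, c = rep M v.next (v.apply d) := by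
  have h0 : symbolBit M.symb (repTape M d none).head = d.rest.head? :=
    symbolBit_inputTape M.symb_injective M.symb_ne_blank _ _
  have h1 : ∀ r, (repTape M d (some (.inl r))).head = M.symb true ↔ d.cnt r = 0 :=
    fun r => counterTape_head (M.symb_ne_blank true) _
  let e := tapeEquiv R (M.k + 1)
  have hsymb : symbolBit M.symb (repTape M d (e (e.symm none))).head = d.rest.head? := by
    rw [Equiv.apply_symm_apply, h0]
  have hzero : (fun r => (repTape M d (e (e.symm (some (.inl r))))).head = M.symb true) =
      fun r => d.cnt r = 0 := by
    funext r
    rw [Equiv.apply_symm_apply, h1]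
  have htape : (fun j => (repTape M d (e (e.symm (some (.inr j))))).head) =
      fun j => (d.tape j).head := by
    funext j
    rw [Equiv.apply_symm_apply]
    rfl
  have hprog : ∀ v, v ∈ P.prog q (symbolBit M.symb (repTape M d (e (e.symm none))).head)
      (fun r => (repTape M d (e (e.symm (some (.inl r))))).head = M.symb true)
      (fun j => (repTape M d (e (e.symm (some (.inr j))))).head) ↔
      v ∈ P.prog q d.rest.head? (fun r => d.cnt r = 0) (fun i => (d.tape i).head) := by
    intro v
    rw [hsymb, hzero, htape]
  have key : ∀ v : CMove R M.Sym P.St (M.k + 1), v.Valid d → ∀ i,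
      (compile M P).act ((rep M q d : (compile M P).Cfg).tape i)
        (match tapeEquiv R (M.k + 1) i with
          | none => (((rep M q d : (compile M P).Cfg).tape i).head,
              if v.adv then some .right else none)
          | some (.inl r) => (((rep M q d : (compile M P).Cfg).tape i).head, v.ops r)
          | some (.inr j) => v.acts j) =
      (rep M v.next (v.apply d) : (compile M P).Cfg).tape i := by
    intro v hv i
    simp only [rep]
    rcases tapeEquiv R (M.k + 1) i with _ | r | j
    · exact actTape_inputTape M.symb d.done d.rest v.adv hv.1
    · exact actTape_counterTape (M.symb true) (v.ops r) (d.cnt r) (hv.2 r)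
    · rfl
  constructor
  · rintro ⟨a, ⟨v, hv, hadv, hops, rfl⟩, hs, ht⟩
    have hval : v.Valid d := ⟨fun h h' => hadv h (hsymb.trans h'), fun r hr h =>
      hops r hr ((congrFun hzero r).mpr h)⟩
    exact ⟨v, ⟨(hprog v).1 hv, hval⟩, NTM.Cfg.ext_tapes hs
      fun i => (ht i).trans (key v hval i)⟩
  · rintro ⟨v, ⟨hv, hval⟩, rfl⟩
    exact ⟨(_, _), ⟨v, (hprog v).2 hv, fun h h' => hval.1 h (hsymb.symm.trans h'),
      fun r hr h => hval.2 r hr ((congrFun hzero r).mp h), rfl⟩, rfl,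
      fun i => (key v hval i).symm⟩

theorem exists_stepsIn_rep_iff [Finite P.St] (t : ℕ) (q : P.St) (d : CData R M.Sym (M.k + 1)) :
    (∃ c, (compile M P).StepsIn t (rep M q d) c ∧ c.state = (compile M P).accept) ↔
      P.Acc t q d := by
  induction t generalizing q d with
  | zero =>
    constructor
    · rintro ⟨c, rfl, h⟩
      exact Option.some_injective _ h
    · intro h
      exact ⟨_, rfl, congrArg some h⟩
  | succ t ih =>
    constructor
    · rintro ⟨c, ⟨e, he, hc⟩, hacc⟩
      obtain ⟨v, hv, rfl⟩ := (step_rep_iff M q d e).1 he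
      exact ⟨v, hv, (ih _ _).1 ⟨c, hc, hacc⟩⟩
    · rintro ⟨v, hv, h⟩
      obtain ⟨c, hc, hacc⟩ := (ih _ _).2 h
      exact ⟨c, ⟨_, (step_rep_iff M q d _).2 ⟨v, hv, rfl⟩, hc⟩, hacc⟩

/-- The initial data of a counter machine on the input `y`. -/
def initData (R Γ : Type) [Inhabited Γ] (m : ℕ) (y : List Bool) : CData R Γ m where
  done := []
  rest := y
  cnt := 0
  tape := fun _ => Tape.mk₁ []

theorem acceptsIn_compile_iff [Finite P.St] (y : List Bool) (t : ℕ) :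
    (compile M P).AcceptsIn y t ↔
      ∃ s, t = s + 1 ∧ P.Acc s P.start (initData R M.Sym (M.k + 1) y) := by
  have hstep : ∀ c, (compile M P).Step ((compile M P).init y) c ↔
      c = rep M P.start (initData R M.Sym (M.k + 1) y) := by
    have htape : ∀ i, (compile M P).act (((compile M P).init y).tape i)
        (match tapeEquiv R (M.k + 1) i with
          | some (.inl _) => (M.symb true, none)
          | _ => ((((compile M P).init y).tape i).head, none)) =
        repTape M (initData R M.Sym (M.k + 1) y) (tapeEquiv R (M.k + 1) i) := by
      intro i
      have hi : i = 0 ↔ tapeEquiv R (M.k + 1) i = none := by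
        rw [← tapeEquiv_zero R (M.k + 1)]
        exact (Equiv.apply_eq_iff_eq (tapeEquiv R (M.k + 1))).symm
      simp only [NTM.init, hi]
      rcases tapeEquiv R (M.k + 1) i with _ | r | j
      · exact Tape.write_self _
      · rfl
      · exact Tape.write_self _
    intro c
    constructor
    · rintro ⟨a, rfl, hs, ht⟩
      exact NTM.Cfg.ext_tapes hs fun i => (ht i).trans (htape i)
    · rintro rfl
      exact ⟨(_, _), rfl, rfl, fun i => (htape i).symm⟩
  constructor
  · rintro ⟨c, hc, hacc⟩
    rcases t with _ | t
    · obtain rfl := hc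
      exact absurd hacc (by simp [NTM.init, compile])
    · obtain ⟨e, he, hc⟩ := hc
      rw [hstep] at he
      subst he
      exact ⟨t, rfl, (exists_stepsIn_rep_iff M t _ _).1 ⟨c, hc, hacc⟩⟩
  · rintro ⟨s, rfl, h⟩
    obtain ⟨c, hc, hacc⟩ := (exists_stepsIn_rep_iff M s _ _).2 h
    exact ⟨c, ⟨_, (hstep _).2 rfl, hc⟩, hacc⟩

end CMachine

end Magnification

namespace Magnification

namespace CMachine

/-! ### Deterministic stretches of computations -/

section

variable {R Γ : Type} [Inhabited Γ] {m : ℕ} {P : CMachine R Γ m}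

/-- From state `q` and data `d`, every accepting computation starts with `τ` steps that lead to
state `q'` and data `d'`, and these steps are possible. -/
def Det (P : CMachine R Γ m) (τ : ℕ) (q : P.St) (d : CData R Γ m) (q' : P.St)
    (d' : CData R Γ m) : Prop :=
  ∀ t, P.Acc t q d ↔ ∃ t', t = t' + τ ∧ P.Acc t' q' d'

theorem Det.trans {τ₁ τ₂ : ℕ} {q₁ q₂ q₃ : P.St} {d₁ d₂ d₃ : CData R Γ m}
    (h₁ : P.Det τ₁ q₁ d₁ q₂ d₂) (h₂ : P.Det τ₂ q₂ d₂ q₃ d₃) :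
    P.Det (τ₁ + τ₂) q₁ d₁ q₃ d₃ := by
  intro t
  rw [h₁ t]
  constructor
  · rintro ⟨t', ht, h⟩
    obtain ⟨s, hs, h⟩ := (h₂ t').1 h
    exact ⟨s, by omega, h⟩
  · rintro ⟨s, hs, h⟩
    exact ⟨s + τ₂, by omega, (h₂ _).2 ⟨s, rfl, h⟩⟩

theorem Det.congr {τ τ' : ℕ} {q q' : P.St} {d d' d'' : CData R Γ m} (h : P.Det τ q d q' d')
    (hτ : τ = τ') (hd : d' = d'') : P.Det τ' q d q' d'' :=
  hτ ▸ hd ▸ h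

theorem acc_iff_of_ne {t : ℕ} {q : P.St} {d : CData R Γ m} (hq : q ≠ P.accept) :
    P.Acc t q d ↔ ∃ t', t = t' + 1 ∧ ∃ v ∈ P.prog q d.rest.head? (fun r => d.cnt r = 0)
      (fun i => (d.tape i).head), v.Valid d ∧ P.Acc t' v.next (v.apply d) := by
  rcases t with _ | t
  · simp [Acc, hq]
  · simp [Acc, movesAt, and_assoc]

theorem Det.single {q : P.St} {d d' : CData R Γ m} {v : CMove R Γ P.St m} (hq : q ≠ P.accept)
    (hp : P.prog q d.rest.head? (fun r => d.cnt r = 0) (fun i => (d.tape i).head) = {v})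
    (hv : v.Valid d) (hd : v.apply d = d') : P.Det 1 q d v.next d' := by
  intro t
  rw [acc_iff_of_ne hq, hp]
  simp [hv, hd]

end

end CMachine

/-! ### The hashed search machine -/

namespace HashSearch

/-- The registers of the search machine: the modulus (later: the clock), the prescribed residue, an
index, the length of the string searched for, its residue as computed so far, and a scratch
register. -/
inductive Reg
  | mdl | res | idx | len | acc | tmp
  deriving DecidableEq

instance : Fintype Reg :=
  ⟨{.mdl, .res, .idx, .len, .acc, .tmp}, fun r => by cases r <;> simp⟩

/-- The cyclic order in which the registers receive the input bits. -/
def Reg.succ : Reg → Reg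
  | .mdl => .res
  | .res => .idx
  | .idx => .len
  | _ => .mdl

/-- The control states of the search machine. -/
inductive Ctl
  | read (j : Reg)
  | unload (j : Reg) (b : Bool)
  | load (j : Reg) (b : Bool)
  | reload (j : Reg) (b : Bool)
  | guess
  | write (f : Bool)
  | reduce
  | subtract
  | restore
  | compare
  deriving Fintype

/-- The control state that follows after a bit has been shifted into the register `j`. -/
def Ctl.after : Reg → Ctl
  | .acc => .reduce
  | j => .read j.succ

/-- The operations that act on the register `r` only. -/
def op (r : Reg) (o : Dir) : Reg → Option Dir := fun x => if x = r then some o else none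

/-- The operations that act on two registers. -/
def op₂ (r r' : Reg) (o o' : Dir) : Reg → Option Dir :=
  fun x => if x = r then some o else if x = r' then some o' else none

variable (M : NTM)

/-- The moves of the search machine. -/
abbrev Move : Type := CMove Reg M.Sym (Ctl ⊕ M.State) (M.k + 1)

/-- The data of the search machine. -/
abbrev Data : Type := CData Reg M.Sym (M.k + 1)

variable {M} in
/-- Replace the values of the registers. -/
abbrev withCnt (d : Data M) (A : Reg → ℕ) : Data M := { d with cnt := A }

open Classical in
/-- The program of the search machine. It reads the registers `mdl`, `res`, `idx`, `len` from the
input, guesses `len` bits, from the last to the first, writes them on the first tape of `M` and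
computes their value modulo `mdl`; the `idx`-th guess has to be `1`. It then compares that value
with `res` and runs `M` for at most `mdl` steps. -/
noncomputable def prog : Ctl ⊕ M.State → Option Bool → (Reg → Prop) → (Fin (M.k + 1) → M.Sym) →
    Set (Move M) := fun q i z h =>
  let keep : Fin (M.k + 1) → M.Sym × Option Dir := fun j => (h j, none)
  match q with
  | .inl (.read j) =>
    match i with
    | none => {⟨.inl .guess, false, fun _ => none, keep⟩}
    | some b => {⟨.inl (.unload j b), true, fun _ => none, keep⟩}
  -- A bit is shifted in by unary doubling: `unload` moves the register to `tmp`, `load` and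
  -- `reload` bring every unit back twice, and finally `b` is added.
  | .inl (.unload j b) =>
    if z j then {⟨.inl (.load j b), false, fun _ => none, keep⟩}
    else {⟨.inl (.unload j b), false, op₂ j .tmp .left .right, keep⟩}
  | .inl (.load j b) =>
    if z .tmp then {⟨.inl (.after j), false, if b then op j .right else fun _ => none, keep⟩}
    else {⟨.inl (.reload j b), false, op₂ .tmp j .left .right, keep⟩}
  | .inl (.reload j b) => {⟨.inl (.load j b), false, op j .right, keep⟩}
  | .inl .guess =>
    if z .len then {⟨.inl .compare, false, fun _ => none, keep⟩}
    else if z .idx then {⟨.inl (.write false), false, op .len .left, keep⟩}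
    else {⟨.inl (.write true), false, op₂ .len .idx .left .left, keep⟩}
  | .inl (.write f) =>
    -- The flag `f` says that `idx` was positive before its last decrement. It distinguishes the
    -- selected position, where `idx` has just become zero, from those with `idx` zero all along.
    {v | ∃ b, (f = true → z .idx → b = true) ∧ v = ⟨.inl (.unload .acc b), false, fun _ => none,
      fun j => if j = 0 then (M.symb b, some .left) else keep j⟩}
  -- Whether to subtract the modulus is guessed. Subtracting too much blocks, since a zero register
  -- cannot be decremented; omitting a subtraction preserves the residue class, and the final
  -- comparison admits only values below the modulus.
  | .inl .reduce =>
    {⟨.inl .guess, false, fun _ => none, keep⟩, ⟨.inl .subtract, false, fun _ => none, keep⟩}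
  | .inl .subtract =>
    if z .mdl then {⟨.inl .restore, false, fun _ => none, keep⟩}
    else {⟨.inl .subtract, false,
      fun x => if x = .mdl ∨ x = .acc then some .left else if x = .tmp then some .right else none,
      keep⟩}
  | .inl .restore =>
    if z .tmp then {⟨.inl .guess, false, fun _ => none, keep⟩}
    else {⟨.inl .restore, false, op₂ .tmp .mdl .left .right, keep⟩}
  -- Decrementing `mdl` along with the residues, and testing it at the end, enforces that the
  -- residue is less than the modulus. The sum `mdl + tmp` is preserved and becomes the clock.
  | .inl .compare =>
    if z .acc ∧ z .res then {v | ¬ z .mdl ∧ v = ⟨.inr M.start, false, fun _ => none,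
      fun j => if j = 0 then (h j, some .right) else keep j⟩}
    else {⟨.inl .compare, false, fun x => if x = .acc ∨ x = .res ∨ x = .mdl then some .left
      else if x = .tmp then some .right else none, keep⟩}
  | .inr q => {v | ∃ r a, (r = .mdl ∨ r = .tmp) ∧ a ∈ M.moves q h ∧
      v = ⟨.inr a.1, false, op r .left, a.2⟩}

/-- The search machine. -/
noncomputable def machine : CMachine Reg M.Sym (M.k + 1) where
  St := Ctl ⊕ M.State
  start := .inl (.read .mdl)
  accept := .inr M.accept
  prog := prog M

instance : Finite (machine M).St :=
  have := M.finiteState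
  inferInstanceAs (Finite (Ctl ⊕ M.State))

variable {M}

@[simp] theorem actTape_keep {Γ : Type} [Inhabited Γ] (T : Tape Γ) :
    actTape T (T.head, none) = T := Tape.write_self T

theorem inl_ne_accept (c : Ctl) : (Sum.inl c : (machine M).St) ≠ (machine M).accept :=
  Sum.inl_ne_inr

theorem det_step {c c' : Ctl} {d : Data M} (ops : Reg → Option Dir) {A : Reg → ℕ}
    (hp : prog M (.inl c) d.rest.head? (fun r => d.cnt r = 0) (fun i => (d.tape i).head) =
      {⟨.inl c', false, ops, fun i => ((d.tape i).head, none)⟩})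
    (hops : ∀ r, ops r = some .left → d.cnt r ≠ 0) (hA : ∀ r, opVal (ops r) (d.cnt r) = A r) :
    (machine M).Det 1 (.inl c) d (.inl c') (withCnt d A) := by
  refine CMachine.Det.single (P := machine M) (inl_ne_accept c) hp
    ⟨fun h => Bool.noConfusion h, hops⟩ ?_
  ext1 <;> simp [CMove.apply]
  exact funext hA

/-! #### Shifting a bit into a register -/

theorem det_unload {j : Reg} (hj : j ≠ .tmp) (b : Bool) (n : ℕ) (d : Data M) (hn : d.cnt j = n) :
    (machine M).Det (n + 1) (.inl (.unload j b)) d (.inl (.load j b))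
      (withCnt d (Function.update (Function.update d.cnt j 0) .tmp (d.cnt .tmp + n))) := by
  induction n generalizing d with
  | zero =>
    refine det_step (fun _ => none) (by simp [prog, hn]) (by simp) fun r => ?_
    rw [← hn, Function.update_eq_self, hn, add_zero, Function.update_eq_self]
    rfl
  | succ n ih =>
    have h1 : (machine M).Det 1 (.inl (.unload j b)) d (.inl (.unload j b))
        (withCnt d (Function.update (Function.update d.cnt j n) .tmp (d.cnt .tmp + 1))) := by
      refine det_step (op₂ j .tmp .left .right) (by simp [prog, hn]) (fun r => ?_) fun r => ?_
      · by_cases hr : r = j <;> simp [op₂, hr, hn]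
      · by_cases hr : r = j
        · subst hr
          simp [op₂, opVal, hn, Function.update_of_ne hj]
        · by_cases hr' : r = .tmp
          · subst hr'
            simp [op₂, opVal, hr]
          · simp [op₂, opVal, hr, hr']
    have h2 := ih (withCnt d (Function.update (Function.update d.cnt j n) .tmp (d.cnt .tmp + 1)))
      (by simp [Function.update_of_ne hj])
    refine (h1.trans h2).congr (by ring) (congrArg (withCnt d) (funext fun r => ?_))
    by_cases hr' : r = .tmp
    · subst hr'
      simp
      ring
    · by_cases hr : r = j <;> simp [hr, hr', hj]

theorem det_load {j : Reg} (hj : j ≠ .tmp) (b : Bool) (n : ℕ) (d : Data M) (hn : d.cnt .tmp = n) :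
    (machine M).Det (2 * n + 1) (.inl (.load j b)) d (.inl (.after j)) (withCnt d
      (Function.update (Function.update d.cnt j (d.cnt j + 2 * n + b.toNat)) .tmp 0)) := by
  induction n generalizing d with
  | zero =>
    refine det_step (if b then op j .right else fun _ => none) (by simp [prog, hn])
      (fun r => ?_) fun r => ?_
    · cases b <;> simp [op]
    · by_cases hr : r = j
      · subst hr
        cases b <;> simp [op, opVal, hj]
      · by_cases hr' : r = .tmp
        · subst hr'
          cases b <;> simp [op, opVal, hr, hn]
        · cases b <;> simp [op, opVal, hr, hr']
  | succ n ih =>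
    have h1 : (machine M).Det 1 (.inl (.load j b)) d (.inl (.reload j b))
        (withCnt d (Function.update (Function.update d.cnt j (d.cnt j + 1)) .tmp n)) := by
      refine det_step (op₂ .tmp j .left .right) (by simp [prog, hn]) (fun r => ?_) fun r => ?_
      · by_cases hr : r = .tmp <;> simp [op₂, hr, hn]
      · by_cases hr' : r = .tmp
        · subst hr'
          simp [op₂, opVal, hn]
        · by_cases hr : r = j
          · subst hr
            simp [op₂, opVal, hr']
          · simp [op₂, opVal, hr, hr']
    have h2 : (machine M).Det 1 (.inl (.reload j b))
        (withCnt d (Function.update (Function.update d.cnt j (d.cnt j + 1)) .tmp n))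
        (.inl (.load j b))
        (withCnt d (Function.update (Function.update d.cnt j (d.cnt j + 2)) .tmp n)) := by
      refine det_step (op j .right) (by simp [prog]) (fun r => ?_) fun r => ?_
      · by_cases hr : r = j <;> simp [op, hr]
      · by_cases hr' : r = .tmp
        · subst hr'
          simp [op, opVal, hj.symm]
        · by_cases hr : r = j
          · subst hr
            simp [op, opVal, hr']
          · simp [op, opVal, hr, hr']
    have h3 := ih (withCnt d (Function.update (Function.update d.cnt j (d.cnt j + 2)) .tmp n))
      (by simp)
    refine ((h1.trans h2).trans h3).congr (by ring) (congrArg (withCnt d) (funext fun r => ?_))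
    by_cases hr' : r = .tmp
    · subst hr'
      simp
    · by_cases hr : r = j
      · subst hr
        simp [hr']
        ring
      · simp [hr, hr']

theorem det_shift {j : Reg} (hj : j ≠ .tmp) (b : Bool) (d : Data M) (hd : d.cnt .tmp = 0) :
    (machine M).Det (3 * d.cnt j + 2) (.inl (.unload j b)) d (.inl (.after j))
      (withCnt d (Function.update d.cnt j (2 * d.cnt j + b.toNat))) := by
  have h1 := det_unload hj b _ d rfl
  have h2 := det_load hj b (d.cnt j)
    (withCnt d (Function.update (Function.update d.cnt j 0) .tmp (d.cnt .tmp + d.cnt j)))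
    (by simp [hd])
  refine (h1.trans h2).congr (by ring) (congrArg (withCnt d) (funext fun r => ?_))
  by_cases hr' : r = .tmp
  · subst hr'
    simp [hj.symm, hd]
  · by_cases hr : r = j
    · subst hr
      simp [hr']
    · simp [hr, hr']

/-! #### Reading the input -/

/-- The registers after the input bits have been shifted in, in cyclic order starting with `j`. -/
def decode : List Bool → Reg → (Reg → ℕ) → Reg → ℕ
  | [], _, A => A
  | b :: y, j, A => decode y j.succ (Function.update A j (2 * A j + b.toNat))

theorem decode_lt (y : List Bool) (j : Reg) (A : Reg → ℕ) (K : ℕ) (hA : ∀ r, A r < K) (r : Reg) :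
    decode y j A r < K * 2 ^ y.length := by
  induction y generalizing j A K with
  | nil => simpa [decode] using hA r
  | cons b y ih =>
    have := ih j.succ (Function.update A j (2 * A j + b.toNat)) (K * 2) (fun r => by
      by_cases hr : r = j
      · subst hr
        have := hA r
        have := Bool.toNat_le b
        simp
        omega
      · have := hA r
        simp [hr]
        omega)
    rw [decode, List.length_cons, pow_succ']
    linarith [mul_assoc K 2 (2 ^ y.length)]

theorem succ_ne_tmp_acc (j : Reg) : j.succ ≠ .tmp ∧ j.succ ≠ .acc := by
  cases j <;> simp [Reg.succ]

theorem decode_of_tmp_acc (y : List Bool) (j : Reg) (hj : j ≠ .tmp ∧ j ≠ .acc) (A : Reg → ℕ) :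
    decode y j A .tmp = A .tmp ∧ decode y j A .acc = A .acc := by
  induction y generalizing j A with
  | nil => simp [decode]
  | cons b y ih =>
    rw [decode]
    have := ih j.succ (succ_ne_tmp_acc j) (Function.update A j (2 * A j + b.toNat))
    simpa [hj.1.symm, hj.2.symm] using this

/-- A shift costs time linear in the register, and each bit read at most doubles the bound on the
registers. The contents of `done` never matter again, hence the existential quantifier. -/
theorem det_read (y : List Bool) (j : Reg) (hj : j ≠ .tmp ∧ j ≠ .acc) (d : Data M)
    (hy : d.rest = y) (hd : d.cnt .tmp = 0) (K : ℕ) (hK : ∀ r, d.cnt r < K) :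
    ∃ τ ≤ y.length * (3 * (K * 2 ^ y.length) + 3) + 1, ∃ done,
      (machine M).Det τ (.inl (.read j)) d (.inl .guess)
        { d with done := done, rest := [], cnt := decode y j d.cnt } := by
  induction y generalizing j d K with
  | nil =>
    refine ⟨1, by omega, d.done, ?_⟩
    refine (det_step (M := M) (c := .read j) (c' := .guess) (d := d) (fun _ => none)
      (by simp [prog, hy]) (by simp) (fun r => rfl)).congr rfl ?_
    ext1
    · rfl
    · exact hy
    · rfl
    · rfl
  | cons b y ih =>
    have h1 : (machine M).Det 1 (.inl (.read j)) d (.inl (.unload j b))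
        { d with done := b :: d.done, rest := y } := by
      refine CMachine.Det.single (P := machine M) (inl_ne_accept _)
        (v := (⟨.inl (.unload j b), true, fun _ => none, fun i => ((d.tape i).head, none)⟩ : Move M))
        (by rw [hy]; rfl) ⟨fun _ => by simp [hy], fun r h => by simp at h⟩ ?_
      ext1 <;> simp [CMove.apply, hy]
      rfl
    have h2 := det_shift (M := M) hj.1 b { d with done := b :: d.done, rest := y } hd
    have ha : Ctl.after j = .read j.succ := by
      cases j <;> simp_all [Ctl.after]
    rw [ha] at h2
    obtain ⟨τ, hτ, done, h3⟩ := ih j.succ (succ_ne_tmp_acc j)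
      { d with done := b :: d.done, rest := y,
               cnt := Function.update d.cnt j (2 * d.cnt j + b.toNat) } rfl
      (by simp [hj.1.symm, hd]) (K * 2) (fun r => by
        by_cases hr : r = j
        · subst hr
          have := hK r
          have := Bool.toNat_le b
          simp
          omega
        · have := hK r
          simp [hr]
          omega)
    refine ⟨_, ?_, done, (h1.trans h2).trans h3⟩
    have hKj := hK j
    have : K ≤ K * 2 ^ (b :: y).length := Nat.le_mul_of_pos_right _ (by positivity)
    -- The product of the register bound and `2 ^` (number of unread bits) is unchanged when a bit
    -- is read.
    have e : K * 2 * 2 ^ y.length = K * 2 ^ (b :: y).length := by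
      rw [List.length_cons, pow_succ]
      ring
    rw [e] at hτ
    simp only [List.length_cons] at *
    nlinarith

end HashSearch

end Magnification

namespace Magnification
namespace HashSearch

variable {M : NTM}

theorem acc_of_eq {t : ℕ} {q : Ctl ⊕ M.State} {d d' : Data M} (h : (machine M).Acc t q d)
    (e : d = d') : (machine M).Acc t q d' :=
  e ▸ h

theorem acc_inl_iff {t : ℕ} {c : Ctl} {d : Data M} :
    (machine M).Acc t (.inl c) d ↔ ∃ t', t = t' + 1 ∧ ∃ v ∈ prog M (.inl c) d.rest.head?
      (fun r => d.cnt r = 0) (fun i => (d.tape i).head), v.Valid d ∧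
      (machine M).Acc t' v.next (v.apply d) :=
  CMachine.acc_iff_of_ne (inl_ne_accept c)

/-! #### Guessing a string -/

/-- Register contents. -/
def regs (p v i n r s : ℕ) : Reg → ℕ
  | .mdl => p
  | .res => v
  | .idx => i
  | .len => n
  | .acc => r
  | .tmp => s

variable (M) in
/-- The tapes of `M` while its input is being guessed; `l` is the part already guessed. -/
def guessTapes (l : List Bool) : Fin (M.k + 1) → Tape M.Sym :=
  fun j => if j = 0 then (Tape.mk₁ (l.map M.symb)).move .left else Tape.mk₁ []

variable (M) in
/-- The data during the guessing phase. -/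
def guessData (e l : List Bool) (p v i n r s : ℕ) : Data M where
  done := e
  rest := []
  cnt := regs p v i n r s
  tape := guessTapes M l

/-- The head waits on the blank just left of the word, so writing there and moving left prepends a
bit. This is why bits are guessed from the last to the first. -/
theorem write_guessTapes (b : Bool) (l : List Bool) :
    (fun j => actTape (guessTapes M l j) (if j = 0 then (M.symb b, some .left)
      else ((guessTapes M l j).head, none))) = guessTapes M (b :: l) := by
  funext j
  by_cases hj : j = 0
  · simp only [hj, if_true, guessTapes, actTape, Tape.mk₁, Tape.mk₂, Tape.move_left_mk',
      Tape.write_mk', List.map_cons, ← ListBlank.cons_mk, ListBlank.tail_cons]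
    rfl
  · simp [hj, guessTapes]

theorem move_right_guessTapes (l : List Bool) :
    (fun j => actTape (guessTapes M l j) (if j = 0 then ((guessTapes M l j).head, some .right)
      else ((guessTapes M l j).head, none))) = (M.init l).tape := by
  funext j
  by_cases hj : j = 0
  · simp [hj, guessTapes, actTape, NTM.init]
  · simp [hj, guessTapes, NTM.init]

/-! ### Guessed subtraction of the modulus. -/

theorem det_restore (e l : List Bool) (v i n r : ℕ) (s p : ℕ) :
    (machine M).Det (s + 1) (.inl .restore) (guessData M e l p v i n r s) (.inl .guess)
      (guessData M e l (p + s) v i n r 0) := by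
  induction s generalizing p with
  | zero =>
    refine det_step (fun _ => none) (by simp [prog, guessData, regs]) (by simp) fun x => ?_
    cases x <;> simp [opVal, guessData, regs]
  | succ s ih =>
    have h1 : (machine M).Det 1 (.inl .restore) (guessData M e l p v i n r (s + 1))
        (.inl .restore) (guessData M e l (p + 1) v i n r s) := by
      refine det_step (op₂ .tmp .mdl .left .right) (by simp [prog, guessData, regs])
        (fun x => ?_) fun x => ?_ <;>
      cases x <;> simp [opVal, op₂, guessData, regs]
    exact (h1.trans (ih (p + 1))).congr (by ring) (by rw [add_right_comm, add_assoc])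

/-- The operations of one round of subtraction. -/
def subtractOps : Reg → Option Dir := fun x =>
  if x = .mdl ∨ x = .acc then some .left else if x = .tmp then some .right else none

theorem det_subtract_step (e l : List Bool) (v i n r s p : ℕ) :
    (machine M).Det 1 (.inl .subtract) (guessData M e l (p + 1) v i n (r + 1) s)
      (.inl .subtract) (guessData M e l p v i n r (s + 1)) := by
  refine det_step subtractOps (by simp [prog, guessData, regs]; rfl) (fun x => ?_) fun x => ?_ <;>
  cases x <;> simp [opVal, subtractOps, guessData, regs]

theorem det_subtract_loop (e l : List Bool) (v i n r : ℕ) (p s : ℕ) :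
    (machine M).Det (p + 1) (.inl .subtract) (guessData M e l p v i n (r + p) s)
      (.inl .restore) (guessData M e l 0 v i n r (s + p)) := by
  induction p generalizing s with
  | zero =>
    refine det_step (fun _ => none) (by simp [prog, guessData, regs]) (by simp) fun x => ?_
    cases x <;> simp [opVal, guessData, regs]
  | succ p ih =>
    exact ((det_subtract_step e l v i n (r + p) s p).trans (ih (s + 1))).congr (by ring)
      (by rw [add_right_comm, add_assoc])

/-- If `acc` runs out before `mdl`, the only programmed move decrements a zero register, so the
computation is stuck. -/
theorem le_of_acc_subtract (e l : List Bool) (v i n : ℕ) (t p r s : ℕ)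
    (h : (machine M).Acc t (.inl .subtract) (guessData M e l p v i n r s)) : p ≤ r := by
  induction p generalizing t r s with
  | zero => exact Nat.zero_le _
  | succ p ih =>
    rcases r with _ | r
    · obtain ⟨t, rfl, w, hw, hval, -⟩ := acc_inl_iff.1 h
      dsimp only [prog] at hw
      split_ifs at hw with hz
      · exact absurd hz (by simp [guessData, regs])
      · obtain rfl := hw
        exact absurd rfl (hval.2 .acc (by simp))
    · obtain ⟨t, rfl, h'⟩ := (det_subtract_step e l v i n r s p t).1 h
      exact Nat.succ_le_succ (ih _ _ _ h')

theorem acc_subtract_iff (e l : List Bool) (v i n p r t : ℕ) :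
    (machine M).Acc t (.inl .subtract) (guessData M e l p v i n r 0) ↔
      p ≤ r ∧ ∃ t', t = t' + (2 * p + 2) ∧
        (machine M).Acc t' (.inl .guess) (guessData M e l p v i n (r - p) 0) := by
  have key : p ≤ r → (machine M).Det (2 * p + 2) (.inl .subtract) (guessData M e l p v i n r 0)
      (.inl .guess) (guessData M e l p v i n (r - p) 0) := by
    intro hp
    have h1 := det_subtract_loop (M := M) e l v i n (r - p) p 0
    rw [Nat.sub_add_cancel hp] at h1
    exact (h1.trans (det_restore e l v i n (r - p) (0 + p) 0)).congr (by ring) (by simp)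
  constructor
  · intro h
    have hp := le_of_acc_subtract e l v i n t p r 0 h
    exact ⟨hp, (key hp t).1 h⟩
  · rintro ⟨hp, h⟩
    exact (key hp t).2 h

theorem acc_reduce_iff (e l : List Bool) (v i n p r t : ℕ) :
    (machine M).Acc t (.inl .reduce) (guessData M e l p v i n r 0) ↔
      ∃ z : Bool, (z = true → p ≤ r) ∧ ∃ t', t = t' + (1 + if z then 2 * p + 2 else 0) ∧
        (machine M).Acc t' (.inl .guess)
          (guessData M e l p v i n (r - if z then p else 0) 0) := by
  have happ : ∀ c, (⟨.inl c, false, fun _ => none,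
      fun j => ((guessTapes M l j).head, none)⟩ : Move M).apply (guessData M e l p v i n r 0) =
      guessData M e l p v i n r 0 := by
    intro c
    ext1 <;> simp [CMove.apply, guessData]
    rfl
  have hval : ∀ c, (⟨.inl c, false, fun _ => none,
      fun j => ((guessTapes M l j).head, none)⟩ : Move M).Valid (guessData M e l p v i n r 0) :=
    fun c => ⟨by simp, by simp⟩
  refine acc_inl_iff.trans ?_
  constructor
  · rintro ⟨t, rfl, w, hw | hw, -, h⟩
    · obtain rfl := hw
      exact ⟨false, by simp, t, rfl, acc_of_eq h (happ _)⟩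
    · obtain rfl := hw
      replace h := acc_of_eq h (happ _)
      obtain ⟨hp, t', rfl, h'⟩ := (acc_subtract_iff e l v i n p r t).1 h
      exact ⟨true, fun _ => hp, t', by simp; ring, h'⟩
  · rintro ⟨_ | _, hz, t, rfl, h⟩
    · refine ⟨t, rfl, _, Or.inl rfl, hval _, ?_⟩
      exact acc_of_eq h (happ _).symm
    · refine ⟨t + (2 * p + 2), by simp; ring, _, Or.inr rfl, hval _, ?_⟩
      exact acc_of_eq ((acc_subtract_iff e l v i n p r _).2 ⟨hz rfl, t, rfl, h⟩) (happ _).symm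

theorem acc_write_iff (e l : List Bool) (f : Bool) (v i n p r t : ℕ) :
    (machine M).Acc t (.inl (.write f)) (guessData M e l p v i n r 0) ↔
      ∃ b : Bool, (f = true → i = 0 → b = true) ∧ ∃ t', t = t' + (3 * r + 3) ∧
        (machine M).Acc t' (.inl .reduce)
          (guessData M e (b :: l) p v i n (2 * r + b.toNat) 0) := by
  have happ : ∀ b, (⟨.inl (.unload .acc b), false, fun _ => none,
      fun j => if j = 0 then (M.symb b, some .left)
        else ((guessTapes M l j).head, none)⟩ : Move M).apply (guessData M e l p v i n r 0) =
      guessData M e (b :: l) p v i n r 0 := by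
    intro b
    ext1
    · rfl
    · rfl
    · rfl
    · exact write_guessTapes b l
  have hdet : ∀ b, (machine M).Det (3 * r + 2) (.inl (.unload .acc b))
      (guessData M e (b :: l) p v i n r 0) (.inl .reduce)
      (guessData M e (b :: l) p v i n (2 * r + b.toNat) 0) := by
    intro b
    refine (det_shift (j := .acc) (by simp) b (guessData M e (b :: l) p v i n r 0) rfl).congr rfl ?_
    ext1
    · rfl
    · rfl
    · funext x
      cases x <;> simp [guessData, regs]
    · rfl
  refine acc_inl_iff.trans ?_
  constructor
  · rintro ⟨t, rfl, w, ⟨b, hb, rfl⟩, -, h⟩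
    obtain ⟨t', rfl, h'⟩ := (hdet b t).1 (acc_of_eq h (happ b))
    exact ⟨b, hb, t', by ring, h'⟩
  · rintro ⟨b, hb, t, rfl, h⟩
    refine ⟨t + (3 * r + 2), by ring, _, ⟨b, hb, rfl⟩, ⟨by simp, by simp⟩, ?_⟩
    exact acc_of_eq ((hdet b _).2 ⟨t, rfl, h⟩) (happ b).symm

/-- One round of guessing: `b` is the guessed bit and `z` the decision to subtract the modulus.
Truncated subtraction keeps an exhausted index at `0`, so `i = 1` holds in at most one round. -/
theorem acc_guess_succ_iff (e l : List Bool) (v i n p r t : ℕ) :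
    (machine M).Acc t (.inl .guess) (guessData M e l p v i (n + 1) r 0) ↔
      ∃ b z : Bool, (i = 1 → b = true) ∧ (z = true → p ≤ 2 * r + b.toNat) ∧
        ∃ t', t = t' + (3 * r + 5 + if z then 2 * p + 2 else 0) ∧
        (machine M).Acc t' (.inl .guess) (guessData M e (b :: l) p v (i - 1) n
          (2 * r + b.toNat - if z then p else 0) 0) := by
  have hdet : (machine M).Det 1 (.inl .guess) (guessData M e l p v i (n + 1) r 0)
      (.inl (.write (decide (i ≠ 0)))) (guessData M e l p v (i - 1) n r 0) := by
    rcases i with _ | i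
    · refine det_step (op .len .left) (by simp [prog, guessData, regs]) (fun x => ?_) fun x => ?_ <;>
      cases x <;> simp [opVal, op, guessData, regs]
    · refine det_step (op₂ .len .idx .left .left) (by simp [prog, guessData, regs])
        (fun x => ?_) fun x => ?_ <;>
      cases x <;> simp [opVal, op₂, guessData, regs]
  have hi : ∀ b : Bool, (decide (i ≠ 0) = true → i - 1 = 0 → b = true) ↔ (i = 1 → b = true) := by
    intro b
    rw [decide_eq_true_iff]
    constructor
    · intro h h1
      exact h (by omega) (by omega)
    · intro h h0 h1
      exact h (by omega)
  rw [hdet t]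
  constructor
  · rintro ⟨t, rfl, h⟩
    obtain ⟨b, hb, t, rfl, h'⟩ := (acc_write_iff e l _ v _ n p r t).1 h
    obtain ⟨z, hz, t, rfl, h''⟩ := (acc_reduce_iff e _ v _ n p _ t).1 h'
    exact ⟨b, z, (hi b).1 hb, hz, t, by ring, h''⟩
  · rintro ⟨b, z, hb, hz, t, rfl, h⟩
    exact ⟨t + (3 * r + 4 + if z then 2 * p + 2 else 0), by ring,
      (acc_write_iff e l _ v _ n p r _).2 ⟨b, (hi b).2 hb,
        t + (1 + if z then 2 * p + 2 else 0), by ring,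
        (acc_reduce_iff e _ v _ n p _ _).2 ⟨z, hz, t, rfl, h⟩⟩⟩

/-! #### Running the given machine -/

/-- Every simulated step consumes one unit of the clock `mdl + tmp`, from whichever of the two
registers is nonzero. -/
theorem acc_run_iff (t : ℕ) (q : M.State) (d : Data M) :
    (machine M).Acc t (.inr q) d ↔
      t ≤ d.cnt .mdl + d.cnt .tmp ∧ ∃ c, M.StepsIn t ⟨q, d.tape⟩ c ∧ c.state = M.accept := by
  induction t generalizing q d with
  | zero =>
    constructor
    · intro h
      exact ⟨Nat.zero_le _, _, rfl, Sum.inr_injective h⟩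
    · rintro ⟨-, c, rfl, h⟩
      exact congrArg Sum.inr h
  | succ t ih =>
    have hsum : ∀ r, r = .mdl ∨ r = .tmp → d.cnt r ≠ 0 →
        opVal (op r .left .mdl) (d.cnt .mdl) + opVal (op r .left .tmp) (d.cnt .tmp) + 1 =
          d.cnt .mdl + d.cnt .tmp := by
      rintro r (rfl | rfl) hr <;> simp [op, opVal] <;> omega
    constructor
    · rintro ⟨w, ⟨⟨r, a, hr, ha, rfl⟩, hval⟩, h⟩
      obtain ⟨ht, c, hc, hacc⟩ := (ih _ _).1 h
      have := hsum r hr (hval.2 r (by simp [op]))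
      refine ⟨?_, c, ⟨_, ⟨a, ha, rfl, fun i => rfl⟩, hc⟩, hacc⟩
      rw [← this]
      exact Nat.succ_le_succ ht
    · rintro ⟨ht, c, ⟨f, ⟨a, ha, hs, htape⟩, hc⟩, hacc⟩
      have : ∃ r, (r = .mdl ∨ r = .tmp) ∧ d.cnt r ≠ 0 := by
        by_cases h : d.cnt .mdl = 0
        · exact ⟨.tmp, Or.inr rfl, by omega⟩
        · exact ⟨.mdl, Or.inl rfl, h⟩
      obtain ⟨r, hr, hr0⟩ := this
      have h := hsum r hr hr0
      refine ⟨⟨.inr a.1, false, op r .left, a.2⟩, ⟨⟨r, a, hr, ha, rfl⟩, by simp, fun x hx => ?_⟩,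
        (ih _ _).2 ⟨?_, c, ?_, hacc⟩⟩
      · by_cases hxr : x = r
        · rw [hxr]
          exact hr0
        · simp [op, hxr] at hx
      · rw [← h] at ht
        exact Nat.le_of_succ_le_succ ht
      · rw [NTM.Cfg.ext_tapes (c := f) (c' := ⟨a.1, _⟩) hs htape] at hc
        exact hc

/-! #### Comparing residues -/

/-- The operations of one round of comparison. -/
def compareOps : Reg → Option Dir := fun x =>
  if x = .acc ∨ x = .res ∨ x = .mdl then some .left else if x = .tmp then some .right else none

theorem det_compare_step (e l : List Bool) (i n p v r s : ℕ) :
    (machine M).Det 1 (.inl .compare) (guessData M e l (p + 1) (v + 1) i n (r + 1) s)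
      (.inl .compare) (guessData M e l p v i n r (s + 1)) := by
  refine det_step compareOps (by simp [prog, guessData, regs]; rfl) (fun x => ?_) fun x => ?_ <;>
  cases x <;> simp [opVal, compareOps, guessData, regs]

theorem acc_compare_zero_iff (e l : List Bool) (i n p s t : ℕ) :
    (machine M).Acc t (.inl .compare) (guessData M e l p 0 i n 0 s) ↔
      p ≠ 0 ∧ ∃ t', t = t' + 1 ∧ t' ≤ p + s ∧ M.AcceptsIn l t' := by
  refine acc_inl_iff.trans ?_
  have happ : (⟨.inr M.start, false, fun _ => none,
      fun j => if j = 0 then ((guessTapes M l j).head, some .right)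
        else ((guessTapes M l j).head, none)⟩ : Move M).apply (guessData M e l p 0 i n 0 s) =
      ⟨e, [], regs p 0 i n 0 s, (M.init l).tape⟩ := by
    ext1
    · rfl
    · rfl
    · rfl
    · exact move_right_guessTapes l
  constructor
  · rintro ⟨t, rfl, w, hw, -, h⟩
    dsimp only [prog] at hw
    split_ifs at hw with hz
    · obtain ⟨hp, rfl⟩ := hw
      exact ⟨hp, t, rfl, (acc_run_iff _ _ _).1 (acc_of_eq h happ)⟩
    · exact absurd ⟨rfl, rfl⟩ hz
  · rintro ⟨hp, t, rfl, h⟩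
    refine ⟨t, rfl, ⟨.inr M.start, false, fun _ => none, fun j => if j = 0
      then ((guessTapes M l j).head, some .right) else ((guessTapes M l j).head, none)⟩,
      ?_, ⟨by simp, by simp⟩, acc_of_eq ((acc_run_iff _ _ _).2 h) happ.symm⟩
    dsimp only [prog]
    split_ifs with hz
    · exact ⟨hp, rfl⟩
    · exact absurd ⟨rfl, rfl⟩ hz

theorem acc_compare_iff (e l : List Bool) (i n p v r s t : ℕ) :
    (machine M).Acc t (.inl .compare) (guessData M e l p v i n r s) ↔
      r = v ∧ v < p ∧ ∃ t', t = t' + (v + 1) ∧ t' ≤ p + s ∧ M.AcceptsIn l t' := by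
  induction v generalizing p r s t with
  | zero =>
    rcases r with _ | r
    · simp [acc_compare_zero_iff, Nat.pos_iff_ne_zero]
    · simp only [Nat.succ_ne_zero, false_and, iff_false]
      intro h
      obtain ⟨t, rfl, w, hw, hval, -⟩ := acc_inl_iff.1 h
      dsimp only [prog] at hw
      split_ifs at hw with hz
      · exact absurd hz (by simp [guessData, regs])
      · obtain rfl := hw
        exact hval.2 .res (by simp) rfl
  | succ v ih =>
    by_cases hr : p ≠ 0 ∧ r ≠ 0
    · obtain ⟨p, rfl⟩ := Nat.exists_eq_succ_of_ne_zero hr.1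
      obtain ⟨r, rfl⟩ := Nat.exists_eq_succ_of_ne_zero hr.2
      rw [det_compare_step e l i n p v r s t]
      constructor
      · rintro ⟨t, rfl, h⟩
        obtain ⟨hrv, hp, t', rfl, ht, h'⟩ := (ih _ _ _ _).1 h
        exact ⟨by omega, by omega, t', by ring, by omega, h'⟩
      · rintro ⟨hrv, hp, t', rfl, ht, h⟩
        exact ⟨t' + (v + 1), by ring,
          (ih _ _ _ _).2 ⟨by omega, by omega, t', rfl, by omega, h⟩⟩
    · constructor
      · intro h
        exfalso
        obtain ⟨t, rfl, w, hw, hval, -⟩ := acc_inl_iff.1 h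
        dsimp only [prog] at hw
        split_ifs at hw with hz
        · exact absurd hz (by simp [guessData, regs])
        · obtain rfl := hw
          exact hr ⟨hval.2 .mdl (by simp), hval.2 .acc (by simp)⟩
      · rintro ⟨h1, h2, -⟩
        omega

theorem acc_guess_zero_iff (e l : List Bool) (i p v r t : ℕ) :
    (machine M).Acc t (.inl .guess) (guessData M e l p v i 0 r 0) ↔
      r = v ∧ v < p ∧ ∃ t', t = t' + (v + 2) ∧ t' ≤ p ∧ M.AcceptsIn l t' := by
  have hdet : (machine M).Det 1 (.inl .guess) (guessData M e l p v i 0 r 0)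
      (.inl .compare) (guessData M e l p v i 0 r 0) :=
    det_step (fun _ => none) (by simp [prog, guessData, regs]) (by simp) fun x => rfl
  rw [hdet t]
  simp only [acc_compare_iff]
  constructor
  · rintro ⟨t, rfl, hr, hv, t', rfl, ht, h⟩
    exact ⟨hr, hv, t', by ring, ht, h⟩
  · rintro ⟨hr, hv, t', rfl, ht, h⟩
    exact ⟨t' + (v + 1), by ring, hr, hv, t', rfl, ht, h⟩

end HashSearch
end Magnification

namespace Magnification
namespace HashSearch

variable {M : NTM}

/-! #### The language of the search machine -/

/-- The number with the binary digits `u`, most significant digit first, after the digits of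
`r`. -/
def binVal (r : ℕ) (u : List Bool) : ℕ := u.foldl (fun r b => 2 * r + b.toNat) r

theorem binVal_modEq {p r r' : ℕ} (h : r ≡ r' [MOD p]) (u : List Bool) :
    binVal r u ≡ binVal r' u [MOD p] := by
  induction u generalizing r r' with
  | nil => exact h
  | cons b u ih => exact ih ((h.mul_left 2).add_right _)

/-- If `i ≤ u.length` is positive, then the entry of `u` with the (one-based) index `i` is `1`. -/
def IndexTrue (i : ℕ) (u : List Bool) : Prop :=
  ∀ k a, i = k + 1 → u[k]? = some a → a = true

theorem indexTrue_cons_iff {i : ℕ} {b : Bool} {u : List Bool} :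
    IndexTrue i (b :: u) ↔ (i = 1 → b = true) ∧ IndexTrue (i - 1) u := by
  constructor
  · intro h
    refine ⟨fun hi => h 0 b hi rfl, fun k a hk hu => h (k + 1) a (by omega) (by simpa using hu)⟩
  · rintro ⟨h1, h2⟩ k a hi hu
    rcases k with _ | k
    · simp at hu
      subst hu
      exact h1 hi
    · exact h2 k a (by omega) (by simpa using hu)

/-- The condition that the search machine checks of the reversed string `u` that it guesses, when
`l` has been guessed before. -/
def Found (M : NTM) (p v i r : ℕ) (u l : List Bool) : Prop :=
  v < p ∧ binVal r u % p = v ∧ IndexTrue i u ∧ ∃ s ≤ p, M.AcceptsIn (u.reverse ++ l) s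

/-- Soundness: whatever reductions are guessed, the accumulator stays in the right class modulo `p`,
and at the end it equals `v < p`. No bound on `r` is needed. -/
theorem exists_found_of_acc (e l : List Bool) (v i n p r t : ℕ)
    (h : (machine M).Acc t (.inl .guess) (guessData M e l p v i n r 0)) :
    ∃ u : List Bool, u.length = n ∧ Found M p v i r u l := by
  induction n generalizing l i r t with
  | zero =>
    obtain ⟨rfl, hv, s, -, hs, h⟩ := (acc_guess_zero_iff e l i p v r t).1 h
    exact ⟨[], rfl, hv, Nat.mod_eq_of_lt hv, by simp [IndexTrue], s, hs, h⟩
  | succ n ih =>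
    obtain ⟨b, z, hb, hz, t, -, h⟩ := (acc_guess_succ_iff e l v i n p r t).1 h
    obtain ⟨u, hu, hv, hr, hi, s, hs, hacc⟩ := ih _ _ _ _ h
    refine ⟨b :: u, by simp [hu], hv, ?_, indexTrue_cons_iff.2 ⟨hb, hi⟩, s, hs, by simpa using hacc⟩
    rw [← hr]
    refine (binVal_modEq ?_ u : _ ≡ _ [MOD p])
    rcases z with _ | _
    · rfl
    · simp only [if_true]
      have := hz rfl
      exact (Nat.mod_eq_sub_mod this)

/-- Completeness: subtracting exactly when `p ≤ 2 * r + b` maintains `r < p`, so that a round takes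
at most `5 * p + 7` steps and the last accumulator is the true residue. -/
theorem exists_acc_of_found (e l : List Bool) (v i p r : ℕ) (hr : r < p) (u : List Bool)
    (h : Found M p v i r u l) : ∃ t ≤ u.length * (5 * p + 7) + (v + 2 + p),
      (machine M).Acc t (.inl .guess) (guessData M e l p v i u.length r 0) := by
  induction u generalizing l i r with
  | nil =>
    obtain ⟨hv, hrv, -, s, hs, h⟩ := h
    have : r = v := by rwa [binVal, List.foldl_nil, Nat.mod_eq_of_lt hr] at hrv
    exact ⟨s + (v + 2), by simp; omega, (acc_guess_zero_iff e l i p v r _).2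
      ⟨this, hv, s, rfl, hs, h⟩⟩
  | cons b u ih =>
    obtain ⟨hv, hrv, hi, s, hs, h⟩ := h
    obtain ⟨hb, hi⟩ := indexTrue_cons_iff.1 hi
    have hb1 := Bool.toNat_le b
    let z : Bool := decide (p ≤ 2 * r + b.toNat)
    let r' := 2 * r + b.toNat - if z then p else 0
    have hr' : r' < p := by
      simp only [r', z, decide_eq_true_eq]
      split_ifs <;> omega
    have hmod : r' ≡ 2 * r + b.toNat [MOD p] := by
      simp only [r', z, decide_eq_true_eq]
      split_ifs with hz
      · exact (Nat.mod_eq_sub_mod hz).symm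
      · rfl
    obtain ⟨t, ht, hacc⟩ := ih (b :: l) (i - 1) r' hr'
      ⟨hv, Eq.trans (binVal_modEq hmod u) hrv, hi, s, hs, by simpa using h⟩
    refine ⟨t + (3 * r + 5 + if z then 2 * p + 2 else 0), ?_,
      (acc_guess_succ_iff e l v i u.length p r _).2 ⟨b, z, hb, by simp [z], t, rfl, hacc⟩⟩
    have : (if z then 2 * p + 2 else 0) ≤ 2 * p + 2 := by split_ifs <;> omega
    have e : (u.length + 1) * (5 * p + 7) = u.length * (5 * p + 7) + (5 * p + 7) := by ring
    rw [List.length_cons, e]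
    omega

/-- The language of the search machine for `M`: with an input `y` that encodes a modulus, a
residue, an index and a length, it asks for a string of the given length and residue that `M`
accepts and that has the bit `1` at the given index, counted from the end. -/
def hashLang (M : NTM) : Language Bool :=
  {y | ∃ u : List Bool, u.length = decode y .mdl 0 .len ∧
    Found M (decode y .mdl 0 .mdl) (decode y .mdl 0 .res) (decode y .mdl 0 .idx) 0 u []}

theorem hashLang_mem_NE (M : NTM) : hashLang M ∈ NE := by
  -- All registers read are below `2 ^ y.length`. There are at most that many rounds, each costing a
  -- constant multiple of it, which gives the exponent `2 * y.length`.
  refine Set.mem_iUnion.2 ⟨2, (machine M).compile M, 21, fun y => ?_⟩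
  obtain ⟨τ, hτ, e, hdet⟩ := det_read (M := M) y .mdl (by simp)
    (CMachine.initData Reg M.Sym (M.k + 1) y) rfl rfl 1 (fun r => Nat.one_pos)
  have hcnt : decode y .mdl 0 = regs (decode y .mdl 0 .mdl) (decode y .mdl 0 .res)
      (decode y .mdl 0 .idx) (decode y .mdl 0 .len) 0 0 := by
    have h := decode_of_tmp_acc y .mdl (by simp) 0
    funext r
    cases r <;> simp [regs, h.1, h.2]
  -- A blank tape is still blank after a move to the left.
  have htape : (fun _ => Tape.mk₁ []) = guessTapes M [] := by
    funext j
    rw [guessTapes]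
    split_ifs
    · exact congrArg (Tape.mk (default : M.Sym) (ListBlank.mk []))
        (ListBlank.cons_head_tail (ListBlank.mk ([] : List M.Sym))).symm
    · rfl
  replace hdet := hdet.congr (d'' := guessData M e [] (decode y .mdl 0 .mdl) (decode y .mdl 0 .res)
    (decode y .mdl 0 .idx) (decode y .mdl 0 .len) 0 0) rfl (by
      ext1
      · rfl
      · rfl
      · exact hcnt
      · exact htape)
  constructor
  · rintro ⟨u, hu, h⟩
    obtain ⟨t, ht, hacc⟩ := exists_acc_of_found e [] _ _ _ _ (Nat.zero_lt_of_lt h.1) u h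
    rw [hu] at ht hacc
    refine ⟨t + τ + 1, ?_, (CMachine.acceptsIn_compile_iff M y _).2
      ⟨t + τ, rfl, (hdet _).2 ⟨t, rfl, hacc⟩⟩⟩
    have hlt : ∀ r, decode y .mdl 0 r < 2 ^ y.length := fun r => by
      simpa using decode_lt y .mdl 0 1 (fun r => Nat.one_pos) r
    have h1 := hlt .mdl
    have h2 := hlt .res
    have h3 := hlt .len
    have h4 : y.length < 2 ^ y.length := Nat.lt_two_pow_self
    rw [one_mul] at hτ
    have : t + τ + 1 ≤ 21 * 2 ^ (2 * y.length) := by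
      rw [show 2 * y.length = y.length + y.length by ring, pow_add]
      generalize 2 ^ y.length = X at *
      generalize y.length = L at *
      have e1 : L * (3 * X + 3) ≤ X * (3 * X + 3) := Nat.mul_le_mul_right _ h4.le
      have e2 : decode y .mdl 0 .len * (5 * decode y .mdl 0 .mdl + 7) ≤ X * (5 * X + 7) :=
        Nat.mul_le_mul h3.le (by omega)
      nlinarith
    show ((t + τ + 1 : ℕ) : ℝ) ≤ 21 * (2 : ℝ) ^ (2 * y.length)
    exact_mod_cast this
  · intro hy t ht
    obtain ⟨s, -, hs⟩ := (CMachine.acceptsIn_compile_iff M y t).1 ht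
    obtain ⟨s', -, hs'⟩ := (hdet s).1 hs
    obtain ⟨u, hu, h⟩ := exists_found_of_acc e [] _ _ _ _ _ _ hs'
    exact hy ⟨u, hu, h⟩

end HashSearch
end Magnification

namespace Magnification

/-! ### Building circuits -/

section

variable {n : ℕ}

/-- Some wire of a list of gates carries the function `f`. -/
def Gates.Computes {s : ℕ} (G : Gates n s) (f : (Fin n → Bool) → Bool) : Prop :=
  ∃ w, ∀ x, Sum.elim x (G.val x) w = f x

/-- The functions in `B` can be computed from the functions in `A` by `k` additional gates. -/
def Computable (k : ℕ) (A B : Set ((Fin n → Bool) → Bool)) : Prop :=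
  ∀ (s : ℕ) (G : Gates n s), (∀ f ∈ A, G.Computes f) → ∃ s' ≤ s + k, ∃ G' : Gates n s',
    (∀ f, G.Computes f → G'.Computes f) ∧ ∀ f ∈ B, G'.Computes f

namespace Computable

variable {k l : ℕ} {A A' B B' C : Set ((Fin n → Bool) → Bool)} {f g h : (Fin n → Bool) → Bool}

theorem mono (h : Computable k A B) (hk : k ≤ l) (hA : A ⊆ A') (hB : B' ⊆ B) :
    Computable l A' B' := by
  intro s G hG
  obtain ⟨s', hs', G', h1, h2⟩ := h s G fun f hf => hG f (hA hf)
  exact ⟨s', by omega, G', h1, fun f hf => h2 f (hB hf)⟩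

theorem of_subset (h : B ⊆ A) : Computable 0 A B :=
  fun s G hG => ⟨s, le_rfl, G, fun _ => id, fun f hf => hG f (h hf)⟩

theorem of_mem (h : f ∈ A) : Computable 0 A {f} :=
  of_subset (Set.singleton_subset_iff.2 h)

/-- Added gates never destroy a wire, so `A` remains available next to `B` and intermediate results
are shared at no cost. -/
theorem trans (h₁ : Computable k A B) (h₂ : Computable l (A ∪ B) C) : Computable (k + l) A C := by
  intro s G hG
  obtain ⟨s₁, hs₁, G₁, h1, h1'⟩ := h₁ s G hG
  obtain ⟨s₂, hs₂, G₂, h2, h2'⟩ := h₂ s₁ G₁ fun f hf => hf.elim (fun hf => h1 f (hG f hf)) (h1' f)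
  exact ⟨s₂, by omega, G₂, fun f hf => h2 f (h1 f hf), h2'⟩

theorem with_left (h : Computable k A B) : Computable k A (A ∪ B) := by
  intro s G hG
  obtain ⟨s₁, hs₁, G₁, h1, h1'⟩ := h s G hG
  exact ⟨s₁, hs₁, G₁, h1, fun f hf => hf.elim (fun hf => h1 f (hG f hf)) (h1' f)⟩

theorem union (h₁ : Computable k A B) (h₂ : Computable l A C) : Computable (k + l) A (B ∪ C) := by
  have h := h₁.trans ((h₂.mono le_rfl Set.subset_union_left subset_rfl).with_left (A := A ∪ B))
  exact h.mono le_rfl subset_rfl (Set.union_subset_union_left _ Set.subset_union_right)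

theorem congr (hf : Computable k A {f}) (e : ∀ x, f x = g x) : Computable k A {g} :=
  (funext e : f = g) ▸ hf

theorem snoc_computes {s : ℕ} {G : Gates n s} (c : Gate (Fin n ⊕ Fin s)) (hf : G.Computes f) :
    (G.snoc c).Computes f := by
  obtain ⟨w | w, hw⟩ := hf
  · exact ⟨.inl w, hw⟩
  · exact ⟨.inr w.castSucc, fun x => by simpa [Gates.val] using hw x⟩

theorem of_gate
    (h : ∀ (s : ℕ) (G : Gates n s), (∀ f ∈ A, G.Computes f) → ∃ c : Gate (Fin n ⊕ Fin s),
      ∀ x, c.eval (Sum.elim x (G.val x)) = f x) : Computable 1 A {f} := by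
  intro s G hG
  obtain ⟨c, hc⟩ := h s G hG
  refine ⟨s + 1, le_rfl, G.snoc c, fun f hf => snoc_computes c hf, ?_⟩
  rintro _ rfl
  exact ⟨.inr (Fin.last s), fun x => by simpa [Gates.val] using hc x⟩

theorem const (b : Bool) : Computable 1 A {fun _ => b} :=
  of_gate fun s G _ => ⟨if b then .tru else .fls, fun x => by cases b <;> rfl⟩

theorem not (hf : Computable k A {f}) : Computable (k + 1) A {fun x => !f x} := by
  refine hf.trans (of_gate fun s G hG => ?_)
  obtain ⟨w, hw⟩ := hG f (Or.inr rfl)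
  exact ⟨.not w, fun x => by simp [Gate.eval, hw]⟩

theorem and (hf : Computable k A {f}) (hg : Computable l A {g}) :
    Computable (k + l + 1) A {fun x => f x && g x} := by
  refine (hf.union hg).trans (of_gate fun s G hG => ?_)
  obtain ⟨w, hw⟩ := hG f (Or.inr (Or.inl rfl))
  obtain ⟨w', hw'⟩ := hG g (Or.inr (Or.inr rfl))
  exact ⟨.and w w', fun x => by simp [Gate.eval, hw, hw']⟩

theorem or (hf : Computable k A {f}) (hg : Computable l A {g}) :
    Computable (k + l + 1) A {fun x => f x || g x} := by
  refine (hf.union hg).trans (of_gate fun s G hG => ?_)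
  obtain ⟨w, hw⟩ := hG f (Or.inr (Or.inl rfl))
  obtain ⟨w', hw'⟩ := hG g (Or.inr (Or.inr rfl))
  exact ⟨.or w w', fun x => by simp [Gate.eval, hw, hw']⟩

theorem xor (hf : f ∈ A) (hg : g ∈ A) : Computable 5 A {fun x => f x ^^ g x} :=
  (((of_mem hf).and (of_mem hg).not).or ((of_mem hf).not.and (of_mem hg))).congr fun x => by
    cases f x <;> cases g x <;> rfl

theorem iUnion_lt (m : ℕ) (B : ℕ → Set ((Fin n → Bool) → Bool))
    (h : ∀ i < m, Computable k A (B i)) : Computable (m * k) A {f | ∃ i < m, f ∈ B i} := by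
  induction m with
  | zero => exact (of_subset (B := ∅) (by simp)).mono (by simp) subset_rfl (by simp)
  | succ m ih =>
    refine ((ih fun i hi => h i (by omega)).union (h m (by omega))).mono (by rw [Nat.succ_mul])
      subset_rfl ?_
    rintro f ⟨i, hi, hf⟩
    rcases Nat.lt_succ_iff_lt_or_eq.1 hi with hi | rfl
    · exact Or.inl ⟨i, hi, hf⟩
    · exact Or.inr hf

theorem iterate (m : ℕ) (B : ℕ → Set ((Fin n → Bool) → Bool)) (h0 : Computable l A (B 0))
    (h : ∀ i < m, Computable k (A ∪ B i) (B (i + 1))) :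
    Computable (l + m * k) A {f | ∃ i ≤ m, f ∈ B i} := by
  induction m with
  | zero => exact h0.mono (by simp) subset_rfl (by simp)
  | succ m ih =>
    have h1 := ih fun i hi => h i (by omega)
    have h2 : Computable k (A ∪ {f | ∃ i ≤ m, f ∈ B i}) (B (m + 1)) :=
      (h m (by omega)).mono le_rfl (Set.union_subset_union_right _ fun f hf => ⟨m, le_rfl, hf⟩)
        subset_rfl
    refine (h1.trans h2.with_left).mono (by rw [Nat.succ_mul]; omega) subset_rfl ?_
    rintro f ⟨i, hi, hf⟩
    rcases Nat.le_succ_iff.1 hi with hi | rfl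
    · exact Or.inl (Or.inr ⟨i, hi, hf⟩)
    · exact Or.inr hf

theorem forall_lt (m : ℕ) (f : ℕ → (Fin n → Bool) → Bool)
    (h : ∀ i < m, Computable k A {f i}) :
    Computable (m * (k + 1) + 1) A {fun x => decide (∀ i < m, f i x = true)} := by
  induction m with
  | zero => exact ((const true).mono (by simp) subset_rfl subset_rfl).congr fun x => by simp
  | succ m ih =>
    refine (((ih fun i hi => h i (by omega)).and (h m (by omega))).congr fun x => ?_).mono
      (by rw [Nat.succ_mul]; omega) subset_rfl subset_rfl
    rw [Bool.eq_iff_iff]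
    simp only [Bool.and_eq_true, decide_eq_true_eq, Nat.lt_succ_iff_lt_or_eq, or_imp, forall_and,
      forall_eq]

/-- The gates of `C` are copied one by one, with existing wires in place of its input variables;
hence no overhead. -/
theorem circuit {m : ℕ} (C : Circuit m) (fs : Fin m → (Fin n → Bool) → Bool)
    (hfs : ∀ i, fs i ∈ A) : Computable C.size A {fun x => C.eval fun i => fs i x} := by
  have key : ∀ {s : ℕ} (G : Gates m s),
      Computable s A {f | ∃ w : Fin s, f = fun x => G.val (fun i => fs i x) w} := by
    intro s G
    induction G with
    | nil => exact (of_subset (B := ∅) (by simp)).mono le_rfl subset_rfl (fun f ⟨w, _⟩ => w.elim0)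
    | @snoc s G c ih =>
      have hw : ∀ (t : ℕ) (G' : Gates n t),
          (∀ f ∈ A ∪ {f | ∃ w : Fin s, f = fun x => G.val (fun i => fs i x) w}, G'.Computes f) →
          ∀ w : Fin m ⊕ Fin s, ∃ w', ∀ x, Sum.elim x (G'.val x) w' =
            Sum.elim (fun i => fs i x) (G.val fun i => fs i x) w := by
        rintro t G' hG' (w | w)
        · exact hG' _ (Or.inl (hfs w))
        · exact hG' _ (Or.inr ⟨w, rfl⟩)
      have h1 : Computable 1 (A ∪ {f | ∃ w : Fin s, f = fun x => G.val (fun i => fs i x) w})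
          {fun x => c.eval (Sum.elim (fun i => fs i x) (G.val fun i => fs i x))} := by
        refine of_gate fun t G' hG' => ?_
        have hw := hw t G' hG'
        rcases c with _ | _ | a | ⟨a, b⟩ | ⟨a, b⟩
        · exact ⟨.tru, fun x => rfl⟩
        · exact ⟨.fls, fun x => rfl⟩
        · obtain ⟨a', ha⟩ := hw a
          exact ⟨.not a', fun x => by simp only [Gate.eval, ha]⟩
        · obtain ⟨a', ha⟩ := hw a
          obtain ⟨b', hb⟩ := hw b
          exact ⟨.and a' b', fun x => by simp only [Gate.eval, ha, hb]⟩
        · obtain ⟨a', ha⟩ := hw a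
          obtain ⟨b', hb⟩ := hw b
          exact ⟨.or a' b', fun x => by simp only [Gate.eval, ha, hb]⟩
      refine (ih.trans h1.with_left).mono le_rfl subset_rfl ?_
      rintro f ⟨w, rfl⟩
      induction w using Fin.lastCases with
      | last => exact Or.inr (by simp [Gates.val])
      | cast w => exact Or.inl (Or.inr ⟨w, by simp [Gates.val]⟩)
  rcases hC : C.out with w | w
  · exact ((of_mem (hfs w)).congr fun x => by simp [Circuit.eval, hC]).mono (Nat.zero_le _)
      subset_rfl subset_rfl
  · refine (key C.gates).mono le_rfl subset_rfl ?_
    rintro _ rfl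
    exact ⟨w, by simp [Circuit.eval, hC]⟩

/-- A function that can be computed from the input variables has a circuit. -/
theorem exists_circuit (h : Computable k {f | ∃ i, f = fun x => x i} {f}) :
    ∃ C : Circuit n, C.size ≤ k ∧ ∀ x, C.eval x = f x := by
  obtain ⟨s, hs, G, -, hG⟩ := h 0 .nil (by
    rintro _ ⟨i, rfl⟩
    exact ⟨.inl i, fun x => rfl⟩)
  obtain ⟨w, hw⟩ := hG f rfl
  exact ⟨⟨s, G, w⟩, by simpa using hs, hw⟩

/-! #### Arithmetic modulo a constant -/

/-- The carry into position `j` in the sum of `y` and `q`. -/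
def carry (y q j : ℕ) : Bool := decide (2 ^ j ≤ y % 2 ^ j + q % 2 ^ j)

/-- The carry is the majority of three bits. As `q` will be a constant, it degenerates to a single
`∧` or `∨` gate. -/
theorem carry_succ (y q j : ℕ) : carry y q (j + 1) =
    if q.testBit j then y.testBit j || carry y q j else y.testBit j && carry y q j := by
  have hy : y % 2 ^ j < 2 ^ j := Nat.mod_lt _ (by positivity)
  have hq : q % 2 ^ j < 2 ^ j := Nat.mod_lt _ (by positivity)
  have hs : ∀ a : ℕ, a % (2 ^ j * 2) = a % 2 ^ j + 2 ^ j * (a.testBit j).toNat := fun a => by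
    rw [Nat.mod_mul, Nat.toNat_testBit]
  simp only [carry, hs, pow_succ]
  cases y.testBit j <;> cases q.testBit j <;> simp <;> omega

theorem testBit_add_eq_xor_carry (y q j : ℕ) :
    (y + q).testBit j = (y.testBit j ^^ (q.testBit j ^^ carry y q j)) := by
  have h := BitVec.getLsbD_add (Nat.lt_succ_self j) (BitVec.ofNat (j + 1) y)
    (BitVec.ofNat (j + 1) q)
  have hm : ∀ a : ℕ, a % 2 ^ (j + 1) % 2 ^ j = a % 2 ^ j := fun a =>
    Nat.mod_mod_of_dvd _ (pow_dvd_pow 2 (Nat.le_succ j))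
  rw [← BitVec.ofNat_add] at h
  simpa only [BitVec.carry, carry, hm, BitVec.getLsbD_ofNat, BitVec.toNat_ofNat, Nat.lt_succ_self,
    decide_true, Bool.true_and, Bool.toNat_false, add_zero, ge_iff_le] using h

/-- The sets of functions that give the lower `m` bits of the values of `H`. -/
def bits (m : ℕ) (H : (Fin n → Bool) → ℕ) : Set ((Fin n → Bool) → Bool) :=
  {f | ∃ j < m, f = fun x => (H x).testBit j}

theorem carries (w q : ℕ) (Y : (Fin n → Bool) → ℕ) (hY : bits w Y ⊆ A) :
    Computable (1 + w) A {f | ∃ j ≤ w, f = fun x => carry (Y x) q j} := by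
  have h := iterate (A := A) (k := 1) (l := 1) w (fun j => {fun x => carry (Y x) q j})
    ((const false).congr fun x => by simp [carry, Nat.mod_one]) (fun j hj => by
      have h1 : Computable 0 (A ∪ {fun x => carry (Y x) q j}) {fun x => (Y x).testBit j} :=
        of_mem (Or.inl (hY ⟨j, hj, rfl⟩))
      have h2 : Computable 0 (A ∪ {fun x => carry (Y x) q j}) {fun x => carry (Y x) q j} :=
        of_mem (Or.inr rfl)
      cases hq : q.testBit j with
      | false => exact (h1.and h2).congr fun x => by simp [carry_succ, hq]
      | true => exact (h1.or h2).congr fun x => by simp [carry_succ, hq])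
  rw [mul_one] at h
  exact h

/-- As `Y < 2 * p`, one conditional subtraction suffices. Adding the complement `q = 2 ^ (m + 1) -
p` does both tasks: the carry out of the top tells whether `p ≤ Y`, and in that case the lower bits
of `Y + q` are those of `Y - p`. A selection by that carry finishes each bit. -/
theorem bits_mod (m p : ℕ) (hp : p ≤ 2 ^ m) (Y : (Fin n → Bool) → ℕ) (hYp : ∀ x, Y x < 2 * p)
    (hY : bits (m + 1) Y ⊆ A) : Computable (12 * (m + 1)) A (bits m fun x => Y x % p) := by
  let q := 2 ^ (m + 1) - p
  have hpq : p + q = 2 ^ (m + 1) := by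
    have : 2 ^ m ≤ 2 ^ (m + 1) := Nat.pow_le_pow_right (by norm_num) (Nat.le_succ m)
    omega
  have hp1 : 2 ^ (m + 1) = 2 ^ m + 2 ^ m := by rw [pow_succ]; ring
  have htop : ∀ x, carry (Y x) q (m + 1) = decide (p ≤ Y x) := by
    intro x
    have := hYp x
    rw [carry, Nat.mod_eq_of_lt (by omega), Nat.mod_eq_of_lt (by omega)]
    congr 1
    rw [eq_iff_iff]
    omega
  have hbit : ∀ j < m, ∀ x, ((carry (Y x) q (m + 1) &&
      ((Y x).testBit j ^^ (q.testBit j ^^ carry (Y x) q j))) ||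
      (!carry (Y x) q (m + 1) && (Y x).testBit j)) = (Y x % p).testBit j := by
    intro j hj x
    have hx := hYp x
    rw [htop, ← testBit_add_eq_xor_carry]
    by_cases h : p ≤ Y x
    · have e : (Y x + q).testBit j = (Y x % p).testBit j := by
        rw [Nat.mod_eq_sub_mod h, Nat.mod_eq_of_lt (by omega),
          show Y x + q = 2 ^ (m + 1) + (Y x - p) by omega, Nat.testBit_two_pow_add_gt (by omega)]
      simp [h, e]
    · simp [h, Nat.mod_eq_of_lt (not_le.1 h)]
  -- The carries take `m + 2` gates. Each output bit takes `10`: at most `6` for the sum, the others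
  -- for the selection.
  refine ((carries (m + 1) q Y hY).trans (iUnion_lt (k := 10) m
    (fun j => {fun x => (Y x % p).testBit j}) fun j hj => ?_)).mono (by omega) subset_rfl ?_
  · have hc : ∀ j ≤ m + 1, (fun x => carry (Y x) q j) ∈
        A ∪ {f | ∃ j ≤ m + 1, f = fun x => carry (Y x) q j} := fun j hj => Or.inr ⟨j, hj, rfl⟩
    have hy : (fun x => (Y x).testBit j) ∈
        A ∪ {f | ∃ j ≤ m + 1, f = fun x => carry (Y x) q j} := Or.inl (hY ⟨j, by omega, rfl⟩)
    have hsum : Computable 6 (A ∪ {f | ∃ j ≤ m + 1, f = fun x => carry (Y x) q j})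
        {fun x => (Y x).testBit j ^^ (q.testBit j ^^ carry (Y x) q j)} := by
      have := xor hy (hc j (by omega))
      cases hq : q.testBit j with
      | false =>
        exact (this.congr fun x => by simp).mono (by norm_num) subset_rfl subset_rfl
      | true => exact this.not.congr fun x => by simp
    have htop := of_mem (hc (m + 1) le_rfl)
    exact (((htop.and hsum).or (htop.not.and (of_mem hy))).congr (hbit j hj)).mono
      (by norm_num) subset_rfl subset_rfl
  · rintro _ ⟨j, hj, rfl⟩
    exact ⟨j, hj, rfl⟩

end Computable

end

end Magnification

namespace Magnification
namespace HashSearch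

/-! ### Encoding queries -/

/-- The input of length `4 * m` for the search machine that encodes the lower `m` bits of the
registers `mdl`, `res`, `idx`, `len`. -/
def encode (a : Reg → ℕ) : ℕ → List Bool
  | 0 => []
  | m + 1 => (a .mdl).testBit m :: (a .res).testBit m :: (a .idx).testBit m ::
      (a .len).testBit m :: encode a m

theorem length_encode (a : Reg → ℕ) (m : ℕ) : (encode a m).length = 4 * m := by
  induction m with
  | zero => rfl
  | succ m ih =>
    simp only [encode, List.length_cons, ih]
    ring

theorem decode_encode (a A : Reg → ℕ) (m : ℕ) :
    ∀ r, r ≠ .acc → r ≠ .tmp →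
      decode (encode a m) .mdl A r = A r * 2 ^ m + a r % 2 ^ m := by
  induction m generalizing A with
  | zero => intro r _ _; simp [encode, decode, Nat.mod_one]
  | succ m ih =>
    intro r h1 h2
    have key : ∀ v w : ℕ, (2 * w + (v.testBit m).toNat) * 2 ^ m + v % 2 ^ m =
        w * 2 ^ (m + 1) + v % 2 ^ (m + 1) := by
      intro v w
      rw [pow_succ, Nat.mod_mul, Nat.toNat_testBit]
      ring
    simp only [encode, decode, Reg.succ]
    rw [ih _ r h1 h2]
    cases r <;> simp_all [Function.update]

/-- Which bit of which register stands at position `k` does not depend on the registers' values. So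
each input of a query circuit can be wired to a constant or to a fixed bit of the residue. -/
theorem getElem?_encode {m k : ℕ} (hk : k < 4 * m) :
    ∃ s < m, ∃ r, r ≠ .acc ∧ r ≠ .tmp ∧ ∀ a, (encode a m)[k]? = some ((a r).testBit s) := by
  induction m generalizing k with
  | zero => omega
  | succ m ih =>
    rcases k with _ | _ | _ | _ | k
    · exact ⟨m, by omega, .mdl, by simp, by simp, fun a => rfl⟩
    · exact ⟨m, by omega, .res, by simp, by simp, fun a => rfl⟩
    · exact ⟨m, by omega, .idx, by simp, by simp, fun a => rfl⟩
    · exact ⟨m, by omega, .len, by simp, by simp, fun a => rfl⟩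
    · obtain ⟨s, hs, r, h1, h2, h⟩ := ih (k := k) (by omega)
      exact ⟨s, by omega, r, h1, h2, fun a => by simpa [encode] using h a⟩

theorem ofFn_encode (a : Reg → ℕ) (m : ℕ) :
    List.ofFn (fun k : Fin (4 * m) => (encode a m).getD k false) = encode a m := by
  refine List.ext_getElem (by simp [length_encode]) fun i h1 h2 => ?_
  simp [List.getElem?_eq_getElem h2]

/-! ### The circuit that makes all queries -/

theorem binVal_append_singleton (r : ℕ) (u : List Bool) (b : Bool) :
    binVal r (u ++ [b]) = 2 * binVal r u + b.toNat := by
  simp [binVal]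

/-- The residue modulo `p` of a bit string, read from its end. -/
def hash {n : ℕ} (p : ℕ) (x : Fin n → Bool) : ℕ := binVal 0 (List.ofFn x).reverse % p

/-- Horner's rule: the step `r ↦ (2 * r + b) % p` is a relabelling of wires, with the input bit as
lowest bit, followed by one modular reduction. -/
theorem computable_bits_hash {n : ℕ} (m p : ℕ) (hp0 : 0 < p) (hp : p ≤ 2 ^ m) :
    Computable (1 + n * (12 * (m + 1))) {f : (Fin n → Bool) → Bool | ∃ i, f = fun x => x i}
      (Computable.bits m (hash p)) := by
  let res : ℕ → (Fin n → Bool) → ℕ := fun t x => binVal 0 ((List.ofFn x).reverse.take t) % p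
  have h := Computable.iterate (k := 12 * (m + 1)) (l := 1)
    (A := {f : (Fin n → Bool) → Bool | ∃ i, f = fun x => x i}) n
    (fun t => Computable.bits m (res t)) ?_ ?_
  · refine h.mono le_rfl subset_rfl fun f hf => ⟨n, le_rfl, ?_⟩
    convert hf using 2
    funext x
    simp only [res, hash]
    rw [List.take_of_length_le (by simp)]
  · refine (Computable.const false).mono le_rfl subset_rfl ?_
    rintro _ ⟨j, -, rfl⟩
    simp [res, binVal]
  · intro t ht
    let Y : (Fin n → Bool) → ℕ := fun x => 2 * res t x + (x (Fin.rev ⟨t, ht⟩)).toNat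
    have hres : ∀ x, res t x < p := fun x => Nat.mod_lt _ hp0
    have hY : (fun x => Y x % p) = res (t + 1) := by
      funext x
      have hlt : t < (List.ofFn x).reverse.length := by simpa using ht
      have hget : (List.ofFn x).reverse[t] = x (Fin.rev ⟨t, ht⟩) := by
        rw [List.getElem_reverse, List.getElem_ofFn]
        congr 1
        ext
        simp [Fin.val_rev]
        omega
      simp only [res, Y]
      rw [List.take_succ_eq_append_getElem hlt, binVal_append_singleton, hget]
      exact ((Nat.mod_modEq _ p).mul_left 2).add_right _
    have h := Computable.bits_mod
      (A := {f : (Fin n → Bool) → Bool | ∃ i, f = fun x => x i} ∪ Computable.bits m (res t))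
      m p hp Y (fun x => by
        have := hres x
        have := Bool.toNat_le (x (Fin.rev ⟨t, ht⟩))
        simp only [Y]
        omega) (by
        rintro _ ⟨j, hj, rfl⟩
        have hYb : ∀ x, Y x = Nat.bit (x (Fin.rev ⟨t, ht⟩)) (res t x) := fun x => by
          rw [Nat.bit_val]
        rcases j with _ | j
        · exact Or.inl ⟨Fin.rev ⟨t, ht⟩, funext fun x => by rw [hYb, Nat.testBit_bit_zero]⟩
        · exact Or.inr ⟨j, by omega, funext fun x => by rw [hYb, Nat.testBit_bit_succ]⟩)
    rwa [hY] at h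

/-- The registers of a query about strings of length `n` with the residue of `x` modulo `p`. -/
def query {n : ℕ} (p : ℕ) (x : Fin n → Bool) (i : ℕ) : Reg → ℕ
  | .mdl => p
  | .res => hash p x
  | .idx => i
  | .len => n
  | _ => 0

/-- The residue and the two constants are computed once and feed all `n + 1` copies of `C`;
comparing an answer with a bit of `x` takes `5` more gates. Indices count from the end of the
string, hence `Fin.rev`. -/
theorem exists_circuit_query {n m p : ℕ} (hp0 : 0 < p) (hp : p ≤ 2 ^ m) (C : Circuit (4 * m)) :
    ∃ D : Circuit n, D.size ≤ 12 * n * (m + 1) + (n + 1) * (C.size + 6) + 5 ∧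
      ∀ x, D.eval x = true ↔
        C.eval (fun k => (encode (query p x 0) m).getD k false) = true ∧
        ∀ (k : ℕ) (hk : k < n), C.eval (fun j => (encode (query p x (k + 1)) m).getD j false) =
          x (Fin.rev ⟨k, hk⟩) := by
  let X : Set ((Fin n → Bool) → Bool) := {f | ∃ i, f = fun x => x i}
  let A : Set ((Fin n → Bool) → Bool) :=
    X ∪ (Computable.bits m (hash p) ∪ ({fun _ => true} ∪ {fun _ => false}))
  have hA : Computable (1 + n * (12 * (m + 1)) + (1 + 1)) X A :=
    ((computable_bits_hash m p hp0 hp).union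
      ((Computable.const true).union (Computable.const false))).with_left
  have hq : ∀ i, Computable C.size A
      {fun x => C.eval (fun k => (encode (query p x i) m).getD k false)} := by
    intro i
    refine Computable.circuit C (fun k x => (encode (query p x i) m).getD k false) fun k => ?_
    obtain ⟨s, hs, r, h1, h2, h⟩ := getElem?_encode k.2
    have hconst : ∀ b : Bool, (fun _ => b) ∈ A := fun b => by
      cases b
      · exact Or.inr (Or.inr (Or.inr rfl))
      · exact Or.inr (Or.inr (Or.inl rfl))
    simp only [List.getD_eq_getElem?_getD, h, Option.getD_some]
    cases r with
    | mdl => exact hconst (p.testBit s)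
    | res => exact Or.inr (Or.inl ⟨s, hs, rfl⟩)
    | idx => exact hconst (i.testBit s)
    | len => exact hconst (n.testBit s)
    | acc => exact absurd rfl h1
    | tmp => exact absurd rfl h2
  let F : ℕ → (Fin n → Bool) → Bool := fun k x => if hk : k < n then
    C.eval (fun j => (encode (query p x (k + 1)) m).getD j false) == x (Fin.rev ⟨k, hk⟩) else true
  have hF : ∀ k < n, Computable (C.size + 5) A {F k} := by
    intro k hk
    refine (hq (k + 1)).trans ?_
    have h1 := Computable.of_mem (f := fun x => C.eval
      (fun j => (encode (query p x (k + 1)) m).getD j false)) 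
      (A := A ∪ {fun x => C.eval fun j => (encode (query p x (k + 1)) m).getD j false})
      (Or.inr rfl)
    have h2 := Computable.of_mem (f := fun x : Fin n → Bool => x (Fin.rev ⟨k, hk⟩))
      (A := A ∪ {fun x => C.eval fun j => (encode (query p x (k + 1)) m).getD j false})
      (Or.inl (Or.inl ⟨_, rfl⟩))
    refine ((h1.and h2).or (h1.not.and h2.not)).congr fun x => ?_
    simp only [F, dif_pos hk]
    generalize C.eval (fun j => (encode (query p x (k + 1)) m).getD j false) = a
    generalize x (Fin.rev ⟨k, hk⟩) = b
    cases a <;> cases b <;> rfl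
  obtain ⟨D, hD, hDx⟩ := (hA.trans (((hq 0).and (Computable.forall_lt n F hF)).mono le_rfl
    Set.subset_union_right subset_rfl)).exists_circuit
  refine ⟨D, hD.trans (by ring_nf; omega), fun x => ?_⟩
  rw [hDx, Bool.and_eq_true, decide_eq_true_eq]
  refine and_congr_right fun _ => forall_congr' fun k => forall_congr' fun hk => ?_
  simp only [F, dif_pos hk, beq_iff_eq]

/-! ### Deciding a sparse language by queries -/

theorem encode_mem_hashLang_iff {M : NTM} {n m p : ℕ} (hp0 : 0 < p) (hp : p < 2 ^ m) (hn : n < 2 ^ m)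
    (x : Fin n → Bool) {i : ℕ} (hi : i < 2 ^ m) :
    encode (query p x i) m ∈ hashLang M ↔
      ∃ u : List Bool, u.length = n ∧ Found M p (hash p x) i 0 u [] := by
  have hr : ∀ r, r ≠ .acc → r ≠ .tmp → query p x i r < 2 ^ m →
      decode (encode (query p x i) m) .mdl 0 r = query p x i r := by
    intro r h1 h2 h
    rw [decode_encode _ _ _ r h1 h2, Nat.mod_eq_of_lt h]
    simp
  have hhash : hash p x < 2 ^ m := (Nat.mod_lt _ hp0).trans hp
  change (∃ u : List Bool, u.length = _ ∧ Found M _ _ _ 0 u []) ↔ _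
  rw [hr .len (by simp) (by simp) hn, hr .mdl (by simp) (by simp) hp,
    hr .res (by simp) (by simp) hhash, hr .idx (by simp) (by simp) hi]
  rfl

/-- Any witness of a query for `x` lies in the slice of `Q` and has the residue of `x`, so by
injectivity all queries share one witness `u`. Their answers are its bits, and comparing them with
`x` tests `u = x`. -/
theorem exists_circuit_of_injOn {M : NTM} {Q : Language Bool} {n m p : ℕ} (hp0 : 0 < p)
    (hp : p < 2 ^ m) (hn : n < 2 ^ m) (hMQ : ∀ x t, M.AcceptsIn x t → x ∈ Q)
    (hQM : ∀ x ∈ Q, x.length = n → ∃ t ≤ p, M.AcceptsIn x t)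
    (hinj : Set.InjOn (fun x : List Bool => binVal 0 x.reverse % p) {x | x ∈ Q ∧ x.length = n})
    (C : Circuit (4 * m)) (hC : ∀ y, C.eval y = true ↔ List.ofFn y ∈ hashLang M) :
    ∃ D : Circuit n, D.size ≤ 12 * n * (m + 1) + (n + 1) * (C.size + 6) + 5 ∧
      ∀ x, D.eval x = true ↔ List.ofFn x ∈ Q := by
  obtain ⟨D, hD, hDx⟩ := exists_circuit_query hp0 hp.le C (n := n)
  refine ⟨D, hD, fun x => ?_⟩
  have hCq : ∀ i < 2 ^ m, C.eval (fun k => (encode (query p x i) m).getD k false) = true ↔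
      ∃ u : List Bool, u.length = n ∧ Found M p (hash p x) i 0 u [] := fun i hi => by
    rw [hC, ofFn_encode, encode_mem_hashLang_iff hp0 hp hn x hi]
  have hrev : ∀ (k : ℕ) (hk : k < n),
      (List.ofFn x).reverse[k]? = some (x (Fin.rev ⟨k, hk⟩)) := by
    intro k hk
    rw [List.getElem?_eq_getElem (by simpa using hk), List.getElem_reverse, List.getElem_ofFn]
    congr 2
    ext
    simp [Fin.val_rev]
    omega
  have hfound : ∀ {i : ℕ} {u : List Bool}, u.length = n → Found M p (hash p x) i 0 u [] →
      u.reverse ∈ {x | x ∈ Q ∧ x.length = n} := by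
    rintro i u hu ⟨-, -, -, s, -, hs⟩
    rw [List.append_nil] at hs
    exact ⟨hMQ _ _ hs, by simpa using hu⟩
  have huniq : ∀ {i j : ℕ} {u w : List Bool}, u.length = n → w.length = n →
      Found M p (hash p x) i 0 u [] → Found M p (hash p x) j 0 w [] → u = w := by
    intro i j u w hu hw hfu hfw
    have := hinj (hfound hu hfu) (hfound hw hfw)
      (by simp only [List.reverse_reverse]; rw [hfu.2.1, hfw.2.1])
    exact List.reverse_injective this
  rw [hDx, hCq 0 (by positivity)]
  constructor
  · rintro ⟨⟨u, hu, hfu⟩, h⟩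
    have : u = (List.ofFn x).reverse := by
      refine List.ext_getElem (by simp [hu]) fun k h1 h2 => ?_
      have hk : k < n := hu ▸ h1
      have e : (List.ofFn x).reverse[k] = x (Fin.rev ⟨k, hk⟩) :=
        Option.some_injective _ ((List.getElem?_eq_getElem h2).symm.trans (hrev k hk))
      rw [e, ← h k hk, Bool.eq_iff_iff, hCq (k + 1) (by omega)]
      constructor
      · intro huk
        refine ⟨u, hu, hfu.1, hfu.2.1, ?_, hfu.2.2.2⟩
        intro j a hj ha
        obtain rfl : k = j := by omega
        rw [List.getElem?_eq_getElem h1, Option.some_inj] at ha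
        exact ha ▸ huk
      · rintro ⟨w, hw, hfw⟩
        obtain rfl := huniq hu hw hfu hfw
        exact hfw.2.2.1 k _ rfl (List.getElem?_eq_getElem h1)
    have hm := (hfound hu hfu).1
    rwa [this, List.reverse_reverse] at hm
  · intro hx
    obtain ⟨t, ht, hacc⟩ := hQM _ hx (by simp)
    have hF : ∀ i, IndexTrue i (List.ofFn x).reverse →
        Found M p (hash p x) i 0 (List.ofFn x).reverse [] := fun i hi =>
      ⟨Nat.mod_lt _ hp0, rfl, hi, t, ht, by simpa using hacc⟩
    have hl : (List.ofFn x).reverse.length = n := by simp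
    -- Index `0` selects no position and so imposes no condition.
    have h0 := hF 0 fun k a hk => by omega
    refine ⟨⟨_, hl, h0⟩, fun k hk => ?_⟩
    rw [Bool.eq_iff_iff, hCq (k + 1) (by omega)]
    constructor
    · rintro ⟨w, hw, hfw⟩
      obtain rfl := huniq hl hw h0 hfw
      exact hfw.2.2.1 k _ rfl (hrev k hk)
    · intro hxk
      refine ⟨_, hl, hF _ fun j a hj ha => ?_⟩
      obtain rfl : k = j := by omega
      rw [hrev k hk, Option.some_inj] at ha
      exact ha ▸ hxk

end HashSearch
end Magnification
open Filter

namespace Magnification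
namespace HashSearch

/-! ### Moduli that separate a small set of strings -/

theorem binVal_lt (u : List Bool) (r : ℕ) : binVal r u < (r + 1) * 2 ^ u.length := by
  induction u generalizing r with
  | nil => simp [binVal]
  | cons b u ih =>
    have h := ih (2 * r + b.toNat)
    have hb := Bool.toNat_le b
    have h2 : (2 * r + b.toNat + 1) * 2 ^ u.length ≤ (2 * (r + 1)) * 2 ^ u.length :=
      Nat.mul_le_mul_right _ (by omega)
    rw [List.length_cons, pow_succ]
    calc binVal r (b :: u) = binVal (2 * r + b.toNat) u := rfl
      _ < (2 * (r + 1)) * 2 ^ u.length := h.trans_le h2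
      _ = (r + 1) * (2 ^ u.length * 2) := by ring

/-- The accumulators must be general: induction gives `2 * r + b = 2 * s + c`, and parity separates
the digits from `r` and `s`. -/
theorem binVal_inj {u v : List Bool} {r s : ℕ} (hl : u.length = v.length)
    (h : binVal r u = binVal s v) : r = s ∧ u = v := by
  induction u generalizing v r s with
  | nil =>
    obtain rfl := List.length_eq_zero_iff.1 hl.symm
    exact ⟨h, rfl⟩
  | cons b u ih =>
    rcases v with _ | ⟨c, v⟩
    · simp at hl
    · obtain ⟨h1, rfl⟩ := ih (v := v) (s := 2 * s + c.toNat) (by simpa using hl)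
        (h : binVal (2 * r + b.toNat) u = binVal (2 * s + c.toNat) v)
      cases b <;> cases c <;> simp at h1 <;> first | omega | exact ⟨by omega, rfl⟩

theorem card_primeFactors_le {D n : ℕ} (h0 : D ≠ 0) (hD : D < 2 ^ n) :
    D.primeFactors.card ≤ n := by
  have h1 : 2 ^ D.primeFactors.card ≤ ∏ p ∈ D.primeFactors, p :=
    Finset.pow_card_le_prod _ _ _ fun p hp => (Nat.prime_of_mem_primeFactors hp).two_le
  have h2 := Nat.le_of_dvd (Nat.pos_of_ne_zero h0) (Nat.prod_primeFactors_dvd D)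
  exact ((Nat.pow_lt_pow_iff_right (by norm_num)).1 ((h1.trans h2).trans_lt hD)).le

/-- Chebyshev's lower bound for the prime counting function, taken at `2 ^ m - 1` so that `log 2`
cancels from the estimate. -/
theorem two_pow_le_mul_primesBelow {m : ℕ} (hm : 2 ≤ m) :
    2 ^ m ≤ m * ((Nat.primesBelow (2 ^ m)).card + 1) + 1 := by
  have h4 : 2 ^ 2 ≤ 2 ^ m := Nat.pow_le_pow_right (by norm_num) hm
  have hcard : (Nat.primesBelow (2 ^ m)).card = Nat.primeCounting (2 ^ m - 1) := by
    rw [Nat.primesBelow_card_eq_primeCounting', Nat.primeCounting,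
      Nat.sub_add_cancel (by omega)]
  have h := Chebyshev.pi_ge (2 ^ m - 1)
  have hcast : ((2 ^ m - 1 : ℕ) : ℝ) = 2 ^ m - 1 := by
    rw [Nat.cast_sub (by omega)]
    simp
  have hR : (4 : ℝ) ≤ 2 ^ m := by exact_mod_cast h4
  have hlog2 : 0 < Real.log 2 := Real.log_pos (by norm_num)
  have hlogpos : 0 < Real.log (2 ^ m - 1) := Real.log_pos (by linarith)
  have hlogle : Real.log (2 ^ m - 1) ≤ m * Real.log 2 := by
    rw [← Real.log_pow]
    exact Real.log_le_log (by linarith) (by linarith)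
  rw [hcast, sub_add_cancel, Real.log_pow, div_le_iff₀ hlogpos, ← hcard] at h
  have h3 := h.trans (mul_le_mul_of_nonneg_left hlogle (Nat.cast_nonneg _))
  have h5 : ((2 : ℝ) ^ m - 1 - m) * Real.log 2 ≤
      ((Nat.primesBelow (2 ^ m)).card * m) * Real.log 2 := by linarith
  have h6 := le_of_mul_le_mul_right h5 hlog2
  have : (2 : ℝ) ^ m ≤ m * ((Nat.primesBelow (2 ^ m)).card + 1) + 1 := by linarith
  exact_mod_cast this

theorem exists_modulus_injOn {n m L : ℕ} (S : Finset (List Bool)) (hS : ∀ x ∈ S, x.length = n)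
    (hm : 2 ≤ m) (h : m * (L + S.card ^ 2 * n + 2) + 1 < 2 ^ m) :
    ∃ p, 0 < p ∧ p < 2 ^ m ∧ L ≤ p ∧
      Set.InjOn (fun x : List Bool => binVal 0 x.reverse % p) S := by
  let val : List Bool → ℕ := fun x => binVal 0 x.reverse
  -- Subtraction is truncated: of each pair of distinct values only one order contributes, and a
  -- zero difference has no prime factors. Removing also `Finset.range L` below forces `L ≤ p`.
  let bad : Finset ℕ := (S ×ˢ S).biUnion fun z => (val z.1 - val z.2).primeFactors
  have hval : ∀ x ∈ S, val x < 2 ^ n := fun x hx => by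
    simpa [val, hS x hx] using binVal_lt x.reverse 0
  have hbad : bad.card ≤ S.card ^ 2 * n := by
    refine (Finset.card_biUnion_le_card_mul _ _ n fun z hz => ?_).trans
      (by rw [Finset.card_product, sq])
    rcases eq_or_ne (val z.1 - val z.2) 0 with h0 | h0
    · simp [h0]
    · exact card_primeFactors_le h0
        ((Nat.sub_le _ _).trans_lt (hval _ (Finset.mem_product.1 hz).1))
  have hcard : (bad ∪ Finset.range L).card < (Nat.primesBelow (2 ^ m)).card := by
    have h1 := two_pow_le_mul_primesBelow hm
    have h2 := Finset.card_union_le bad (Finset.range L)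
    rw [Finset.card_range] at h2
    have h3 : m * (L + S.card ^ 2 * n + 2) < m * ((Nat.primesBelow (2 ^ m)).card + 1) := by omega
    have h4 := lt_of_mul_lt_mul_left h3 (Nat.zero_le m)
    omega
  obtain ⟨p, hp, hpn⟩ := Finset.exists_mem_notMem_of_card_lt_card hcard
  obtain ⟨hpm, hprime⟩ := Nat.mem_primesBelow.1 hp
  rw [Finset.mem_union, not_or, Finset.mem_range, not_lt] at hpn
  have hsub : ∀ x ∈ S, ∀ y ∈ S, val x % p = val y % p → val x ≤ val y := by
    intro x hx y hy hxy
    by_contra hlt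
    refine hpn.1 (Finset.mem_biUnion.2 ⟨(x, y), Finset.mem_product.2 ⟨hx, hy⟩,
      Nat.mem_primeFactors.2 ⟨hprime, ?_, Nat.sub_ne_zero_of_lt (not_le.1 hlt)⟩⟩)
    exact (Nat.modEq_iff_dvd' (not_le.1 hlt).le).1 (show val y ≡ val x [MOD p] from hxy.symm)
  refine ⟨p, hprime.pos, hpm, hpn.2, fun x hx y hy hxy => ?_⟩
  have := (hsub x hx y hy hxy).antisymm (hsub y hy x hx hxy.symm)
  exact List.reverse_injective (binVal_inj (by simp [hS x hx, hS y hy]) this).2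

/-! ### Growth rates -/

theorem eventually_le_two_rpow {a : ℝ} (ha : 0 < a) {ε : ℝ} (hε : 0 < ε) :
    ∀ᶠ x : ℝ in atTop, x ≤ 2 ^ (ε * x ^ a) := by
  have hlog2 : 0 < Real.log 2 := Real.log_pos (by norm_num)
  have h := (isLittleO_log_rpow_atTop ha).bound (mul_pos hε hlog2)
  filter_upwards [h, eventually_ge_atTop 1] with x hx h1
  rw [Real.norm_of_nonneg (Real.log_nonneg h1), Real.norm_of_nonneg (by positivity)] at hx
  rw [← Real.log_le_log_iff (by linarith) (by positivity), Real.log_rpow (by norm_num)]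
  linarith

theorem eventually_const_mul_rpow_le {a b : ℝ} (hab : a < b) (B : ℝ) :
    ∀ᶠ x : ℝ in atTop, B * x ^ a ≤ x ^ b := by
  filter_upwards [(tendsto_rpow_atTop (sub_pos.2 hab)).eventually_ge_atTop B,
    eventually_gt_atTop 0] with x hx h0
  calc B * x ^ a ≤ x ^ (b - a) * x ^ a := by gcongr
    _ = x ^ b := by rw [← Real.rpow_add h0, sub_add_cancel]

/-- Moduli of `⌈n ^ β⌉` bits suffice for a `2 ^ n ^ γ`-sparse set and a time bound
`B * 2 ^ n ^ γ`, if `γ < β`. -/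
theorem eventually_modulus_bound {γ β : ℝ} (hβ : 0 < β) (hγβ : γ < β) (B : ℝ) (hB : 0 ≤ B) :
    ∀ᶠ n : ℕ in atTop, n < 2 ^ ⌈(n : ℝ) ^ β⌉₊ ∧ ∀ k : ℕ, (k : ℝ) ≤ 2 ^ ((n : ℝ) ^ γ) →
      ⌈(n : ℝ) ^ β⌉₊ * (⌈B * 2 ^ ((n : ℝ) ^ γ)⌉₊ + k ^ 2 * n + 2) + 1 < 2 ^ ⌈(n : ℝ) ^ β⌉₊ := by
  have hβt : Tendsto (fun n : ℕ => (n : ℝ) ^ β) atTop atTop :=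
    (tendsto_rpow_atTop hβ).comp tendsto_natCast_atTop_atTop
  filter_upwards [tendsto_natCast_atTop_atTop.eventually (eventually_const_mul_rpow_le hγβ 8),
    tendsto_natCast_atTop_atTop.eventually (eventually_le_two_rpow hβ (ε := 1 / 8) (by norm_num)),
    hβt.eventually (eventually_le_two_rpow one_pos (ε := 1 / 16) (by norm_num)),
    hβt.eventually_ge_atTop (B + 5), hβt.eventually_ge_atTop 16, eventually_ge_atTop 1]
    with n h1 h2 h3 h4 h5 h6
  rw [Real.rpow_one] at h3
  set a := (n : ℝ) ^ β with ha
  set E : ℝ := 2 ^ ((n : ℝ) ^ γ) with hE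
  -- This is a common bound: `E`, `n`, `m` and `B + 5` are all at most `X`, while `X ^ 8 ≤ 2 ^ m`.
  -- The quantity to estimate has only five such factors.
  set X : ℝ := 2 ^ (1 / 8 * a) with hX
  set m := ⌈a⌉₊ with hm
  have hn1 : (1 : ℝ) ≤ n := by exact_mod_cast h6
  have hE1 : 1 ≤ E := Real.one_le_rpow (by norm_num) (by positivity)
  have hEX : E ≤ X := Real.rpow_le_rpow_of_exponent_le (by norm_num) (by linarith)
  have hX1 : 1 ≤ X := hE1.trans hEX
  have h3' : (2 : ℝ) ^ (1 / 16 * a) * 2 ^ (1 / 16 * a) = X := by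
    rw [← Real.rpow_add (by norm_num), hX]
    congr 1
    ring
  have haX : a + 1 ≤ X := by
    rw [← h3']
    nlinarith
  have hBX : B + 5 ≤ X := by linarith
  have ham : a ≤ m := Nat.le_ceil a
  have hma : (m : ℝ) ≤ a + 1 := (Nat.ceil_lt_add_one (by linarith)).le
  have hm1 : (1 : ℝ) ≤ m := by linarith
  have hpow : X ^ 8 ≤ (2 : ℝ) ^ m := by
    rw [hX, ← Real.rpow_natCast, ← Real.rpow_mul (by norm_num), ← Real.rpow_natCast]
    refine Real.rpow_le_rpow_of_exponent_le (by norm_num) ?_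
    push_cast
    linarith
  have hXgt : 1 < X := by linarith
  have hX8 : X ^ 5 < X ^ 8 := pow_lt_pow_right₀ hXgt (by norm_num)
  constructor
  · have h : (n : ℝ) < 2 ^ m := by
      calc (n : ℝ) ≤ X := h2
        _ = X ^ 1 := (pow_one X).symm
        _ < X ^ 8 := pow_lt_pow_right₀ hXgt (by norm_num)
        _ ≤ 2 ^ m := hpow
    exact_mod_cast h
  · intro k hk
    have hceil : (⌈B * E⌉₊ : ℝ) ≤ B * E + 1 := (Nat.ceil_lt_add_one (by positivity)).le
    have hE2 : E ≤ E ^ 2 * n := by nlinarith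
    have hk2 : (k : ℝ) ^ 2 * n ≤ E ^ 2 * n := by gcongr
    have hEn1 : 1 ≤ E ^ 2 * n := hE1.trans hE2
    have h : (m : ℝ) * (⌈B * E⌉₊ + k ^ 2 * n + 2) + 1 < 2 ^ m := by
      -- Everything is absorbed into multiples of `E ^ 2 * n`; the `5` in `B + 5` collects the
      -- rounding, the term `k ^ 2 * n`, the summand `2` and the final `1`.
      calc (m : ℝ) * (⌈B * E⌉₊ + k ^ 2 * n + 2) + 1
          ≤ m * (B * (E ^ 2 * n) + E ^ 2 * n + E ^ 2 * n + 2 * (E ^ 2 * n)) +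
            m * (E ^ 2 * n) := by
            have : B * E ≤ B * (E ^ 2 * n) := by gcongr
            have h1' : 1 ≤ m * (E ^ 2 * n) := one_le_mul_of_one_le_of_one_le hm1 hEn1
            have h2' : (⌈B * E⌉₊ + k ^ 2 * n + 2 : ℝ) ≤
              B * (E ^ 2 * n) + E ^ 2 * n + E ^ 2 * n + 2 * (E ^ 2 * n) := by linarith
            have := mul_le_mul_of_nonneg_left h2' (Nat.cast_nonneg (α := ℝ) m)
            linarith
        _ = m * ((B + 5) * (E ^ 2 * n)) := by ring
        _ ≤ X * (X * (X ^ 2 * X)) := by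
            have : (m : ℝ) ≤ X := hma.trans haX
            gcongr
        _ = X ^ 5 := by ring
        _ < X ^ 8 := hX8
        _ ≤ 2 ^ m := hpow
    exact_mod_cast h

/-- With `a = n ^ β`, the term `n * a ^ (c + 1)` dominates both the hashing cost `n * a` and the
query cost `n * a ^ c`; the strict inequality of exponents absorbs the constant `53 + 2 * 8 ^ c`. -/
theorem eventually_size_bound {β δ : ℝ} (hβ : 0 < β) (c : ℕ) (h : β * (c + 1) < δ) :
    ∀ᶠ n : ℕ in atTop, ∀ s : ℕ, (s : ℝ) ≤ ((4 * ⌈(n : ℝ) ^ β⌉₊ : ℕ) : ℝ) ^ c →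
      ((12 * n * (⌈(n : ℝ) ^ β⌉₊ + 1) + (n + 1) * (s + 6) + 5 : ℕ) : ℝ) ≤ (n : ℝ) ^ (1 + δ) := by
  have hβt : Tendsto (fun n : ℕ => (n : ℝ) ^ β) atTop atTop :=
    (tendsto_rpow_atTop hβ).comp tendsto_natCast_atTop_atTop
  filter_upwards [tendsto_natCast_atTop_atTop.eventually
    (eventually_const_mul_rpow_le h (53 + 2 * 8 ^ c)), hβt.eventually_ge_atTop 1,
    eventually_ge_atTop 1] with n h1 h2 h3 s hs
  have hn1 : (1 : ℝ) ≤ n := by exact_mod_cast h3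
  have hn0 : (0 : ℝ) < n := by linarith
  have hpow : (n : ℝ) ^ (β * (c + 1)) = ((n : ℝ) ^ β) ^ (c + 1) := by
    rw [Real.rpow_mul hn0.le, ← Real.rpow_natCast]
    push_cast
    rfl
  rw [hpow] at h1
  set a := (n : ℝ) ^ β with ha
  have hm : (⌈a⌉₊ : ℝ) ≤ 2 * a := by
    have := (Nat.ceil_lt_add_one (show 0 ≤ a by linarith)).le
    linarith
  have hs' : (s : ℝ) ≤ 8 ^ c * a ^ (c + 1) := by
    calc (s : ℝ) ≤ (4 * (2 * a)) ^ c := hs.trans (by push_cast; gcongr)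
      _ = 8 ^ c * a ^ c := by rw [← mul_assoc, mul_pow]; norm_num
      _ ≤ 8 ^ c * a ^ (c + 1) := by gcongr; exacts [Nat.le_succ c]
  have ha1 : a ≤ a ^ (c + 1) := le_self_pow₀ h2 (by omega)
  have ha2 : 1 ≤ a ^ (c + 1) := h2.trans ha1
  rw [Real.rpow_add hn0, Real.rpow_one]
  calc ((12 * n * (⌈a⌉₊ + 1) + (n + 1) * (s + 6) + 5 : ℕ) : ℝ)
      = 12 * n * (⌈a⌉₊ + 1) + (n + 1) * (s + 6) + 5 := by push_cast; ring
    _ ≤ 12 * n * (3 * a ^ (c + 1)) + (2 * n) * (8 ^ c * a ^ (c + 1) + 6 * a ^ (c + 1)) +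
        5 * (n * a ^ (c + 1)) := by
        have h5 : 1 ≤ n * a ^ (c + 1) := one_le_mul_of_one_le_of_one_le hn1 ha2
        have h6 : (⌈a⌉₊ : ℝ) + 1 ≤ 3 * a ^ (c + 1) := by linarith
        have h7 : (s : ℝ) + 6 ≤ 8 ^ c * a ^ (c + 1) + 6 * a ^ (c + 1) := by linarith
        have h8 : (n : ℝ) + 1 ≤ 2 * n := by linarith
        have e1 := mul_le_mul_of_nonneg_left h6 (show 0 ≤ 12 * (n : ℝ) by positivity)
        have e2 := mul_le_mul h8 h7 (by positivity) (by positivity)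
        linarith
    _ = n * ((53 + 2 * 8 ^ c) * a ^ (c + 1)) := by ring
    _ ≤ n * n ^ δ := by gcongr

end HashSearch

/-! ### The magnification theorem. -/

/-- Hardness magnification: if `NE` has circuits of size `n ^ c`, then a sparse language in
nondeterministic time `2 ^ n ^ γ` has circuits of size `n ^ (1 + δ)`. -/
theorem mem_SIZE_of_NE_subset (c : ℕ) (δ γ : ℝ) (hδ : 0 < δ) (hγ : γ < δ / ((c : ℝ) + 1))
    (Q : Language Bool) (hsparse : IsSparse (fun n => (2 : ℝ) ^ ((n : ℝ) ^ γ)) Q)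
    (htime : Q ∈ NTIME (fun n => (2 : ℝ) ^ ((n : ℝ) ^ γ)))
    (hNE : NE ⊆ SIZE (fun n => (n : ℝ) ^ c)) : Q ∈ SIZE (fun n => (n : ℝ) ^ (1 + δ)) := by
  have hc : (0 : ℝ) < c + 1 := by positivity
  -- Since `γ` may be negative, `β` is also required to be positive, so that the number of bits of
  -- the modulus tends to infinity.
  obtain ⟨β, hβ, hβδ⟩ := exists_between (max_lt hγ (div_pos hδ hc))
  obtain ⟨hγβ, hβ0⟩ := max_lt_iff.1 hβ
  rw [lt_div_iff₀ hc] at hβδ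
  obtain ⟨M, B, hM⟩ := htime
  have hβt : Tendsto (fun n : ℕ => ⌈(n : ℝ) ^ β⌉₊) atTop atTop :=
    tendsto_nat_ceil_atTop.comp ((tendsto_rpow_atTop hβ0).comp tendsto_natCast_atTop_atTop)
  -- Circuits for `hashLang M` are only promised at large lengths; the query length `4 * m`
  -- eventually exceeds any threshold.
  have hsize := (hβt.const_mul_atTop' (r := 4) (by norm_num)).eventually
    (hNE (HashSearch.hashLang_mem_NE M))
  -- The constant hidden in the time bound has no prescribed sign, hence `|B|`.
  filter_upwards [hsize, HashSearch.eventually_modulus_bound hβ0 hγβ |B| (abs_nonneg B),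
    HashSearch.eventually_size_bound hβ0 c hβδ, hβt.eventually_ge_atTop 2]
    with n ⟨C, hCs, hC⟩ ⟨hn, hmod⟩ hbound hm
  have hfin : {x : List Bool | x ∈ Q ∧ x.length = n}.Finite :=
    (List.finite_length_eq Bool n).subset fun x hx => hx.2
  have hcard : hfin.toFinset.card = {x : List Bool | x ∈ Q ∧ x.length = n}.ncard :=
    (Set.ncard_eq_toFinset_card _ hfin).symm
  obtain ⟨p, hp0, hp, hL, hinj⟩ := HashSearch.exists_modulus_injOn hfin.toFinset
    (fun x hx => (hfin.mem_toFinset.1 hx).2) hm (hmod _ (hcard ▸ hsparse n))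
  rw [hfin.coe_toFinset] at hinj
  obtain ⟨D, hD, hDx⟩ := HashSearch.exists_circuit_of_injOn hp0 hp hn (M := M) (Q := Q)
    (fun x t h => by_contra fun hx => (hM x).2 hx t h)
    (fun x hx hl => by
      obtain ⟨t, ht, hacc⟩ := (hM x).1 hx
      refine ⟨t, ?_, hacc⟩
      rw [hl] at ht
      have h1 : B * (2 : ℝ) ^ ((n : ℝ) ^ γ) ≤ |B| * (2 : ℝ) ^ ((n : ℝ) ^ γ) :=
        mul_le_mul_of_nonneg_right (le_abs_self B) (by positivity)
      exact (Nat.cast_le (α := ℝ).1 ((ht.trans h1).trans (Nat.le_ceil _))).trans hL)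
    hinj C hC
  exact ⟨D, (Nat.cast_le.2 hD).trans (hbound C.size hCs), hDx⟩

end Magnification

theorem mainTheorem9 (c : ℕ) (δ γ : ℝ) (hδ : 0 < δ) (hγ : γ < δ / ((c : ℝ) + 1))
    (Q : Language Bool)
    (hsparse : Magnification.IsSparse (fun n => (2 : ℝ) ^ ((n : ℝ) ^ γ)) Q)
    (htime : Q ∈ Magnification.NTIME (fun n => (2 : ℝ) ^ ((n : ℝ) ^ γ)))
    (hsize : Q ∉ Magnification.SIZE (fun n => (n : ℝ) ^ (1 + δ))) :
    ¬ Magnification.NE ⊆ Magnification.SIZE (fun n => (n : ℝ) ^ c) :=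
  fun h => hsize (Magnification.mem_SIZE_of_NE_subset c δ γ hδ hγ Q hsparse htime h)
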